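/- Let $Q$ be a smooth manifold of dimension $n$ and let $\mathcal D\subset TQ$ be a smooth distribution of constant rank $r$, i.e. a family of subspaces $\mathcal D_x\subset T_xQ$ that is locally spanned by $r$ pointwise linearly independent smooth vector fields. Regard $\mathcal D$ as a smooth manifold (the total space of a vector bundle $\tau_{\mathcal D}:\mathcal D\to Q$ of rank $r$). A smooth curve $\gamma:I\to\mathcal D$ is called admissible if there is a curve $\sigma:I\to Q$ with $\tau_{\mathcal D}\circ\gamma=\sigma$ and $\gamma(t)=\dot\sigma(t)$ for all $t\in I$. Put $$\mathcal D^{(2)}=\{v\in T\mathcal D \mid v=\dot\gamma(0)\text{ for some admissible curve }\gamma\}.$$ Then $\mathcal D^{(2)}$ is an embedded submanifold of $T\mathcal D$ of dimension $n+2r$. Moreover, let $\mathcal L:\mathcal D^{(2)}\to\mathbb R$ be a $C^\infty$ function, and let $\omega_{T\mathcal D}=-d\theta_{T\mathcal D}$ be the canonical symplectic form of the cotangent bundle $\pi:T^*T\mathcal D\to T\mathcal D$, where $\theta_{T\mathcal D}$ is the Liouville one-form. Then $$\Sigma_{\mathcal L}=\{\mu\in T^*T\mathcal D\mid \pi(\mu)\in\mathcal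 D^{(2)}\text{ and }\langle\mu,v\rangle=\langle d\mathcal L,v\rangle\text{ for all }v\in T_{\pi(\mu)}\mathcal D^{(2)}\}$$ is a Lagrangian submanifold of $(T^*T\mathcal D,\omega_{T\mathcal D})$: it is an embedded submanifold, its dimension is half of the dimension of $T^*T\mathcal D$, and the pullback of $\omega_{T\mathcal D}$ to it vanishes. -/

import Mathlib

open Bundle Set Manifold Topology
open scoped ContDiff

noncomputable section

namespace LagrangianSigma

/-! ### Distributions of constant rank and their total spaces -/

section Distribution

variable {n : ℕ} {Q : Type*} [TopologicalSpace Q] [ChartedSpace (EuclideanSpace ℝ (Fin n)) Q]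
  [IsManifold (𝓡 n) ∞ Q]

/-- The vector fields `e 0, …, e (r-1)` are smooth on the open set `U`, and at every point `x` of
`U` they form a basis of the subspace `S x` of the tangent space at `x`. -/
structure IsFrameOn {r : ℕ} (S : ∀ x : Q, Submodule ℝ (TangentSpace (𝓡 n) x)) (U : Set Q)
    (e : Fin r → ∀ x : Q, TangentSpace (𝓡 n) x) : Prop where
  isOpen : IsOpen U
  smooth : ∀ A, ContMDiffOn (𝓡 n) (𝓡 n).tangent ∞
    (fun x => (⟨x, e A x⟩ : TangentBundle (𝓡 n) Q)) U
  linearIndependent : ∀ x ∈ U, LinearIndependent ℝ (fun A => e A x)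
  span_eq : ∀ x ∈ U, Submodule.span ℝ (range fun A => e A x) = S x

variable (n Q) in
/-- A smooth distribution of constant rank `r` on the `n`-dimensional manifold `Q`: a family of
subspaces of the tangent spaces that is locally spanned by `r` pointwise linearly independent
smooth vector fields. -/
structure Distribution (r : ℕ) where
  space : ∀ x : Q, Submodule ℝ (TangentSpace (𝓡 n) x)
  exists_frame : ∀ x : Q, ∃ (U : Set Q) (e : Fin r → ∀ y : Q, TangentSpace (𝓡 n) y),
    x ∈ U ∧ IsFrameOn space U e

namespace Distribution

variable {r : ℕ} (D : Distribution n Q r)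

/-- The fibre of the distribution at `x`, as a type. -/
def Fiber (x : Q) : Type := D.space x

instance (x : Q) : AddCommGroup (D.Fiber x) := inferInstanceAs (AddCommGroup (D.space x))
instance (x : Q) : Module ℝ (D.Fiber x) := inferInstanceAs (Module ℝ (D.space x))
instance (x : Q) : TopologicalSpace (D.Fiber x) := inferInstanceAs (TopologicalSpace (D.space x))
instance (x : Q) : IsTopologicalAddGroup (D.Fiber x) :=
  inferInstanceAs (IsTopologicalAddGroup (D.space x))
instance (x : Q) : ContinuousSMul ℝ (D.Fiber x) :=
  inferInstanceAs (ContinuousSMul ℝ (D.space x))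
instance (x : Q) : T2Space (D.Fiber x) := by
  have : T2Space (TangentSpace (𝓡 n) x) :=
    inferInstanceAs (T2Space (EuclideanSpace ℝ (Fin n)))
  exact inferInstanceAs (T2Space (D.space x))

/-- The inclusion of the fibre at `x` in the tangent space at `x`. -/
def fiberIncl (x : Q) : D.Fiber x →ₗ[ℝ] TangentSpace (𝓡 n) x := (D.space x).subtype

section Frame

variable {D} {U : Set Q} {e : Fin r → ∀ y : Q, TangentSpace (𝓡 n) y}

/-- The basis of the fibre given by a frame. -/
def frameBasis (h : IsFrameOn D.space U e) {x : Q} (hx : x ∈ U) :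
    Module.Basis (Fin r) ℝ (D.Fiber x) :=
  (Module.Basis.span (h.linearIndependent x hx)).map (LinearEquiv.ofEq _ _ (h.span_eq x hx))

/-- Linear coordinates `y^A` on the fibre with respect to a frame. -/
def frameEquiv (h : IsFrameOn D.space U e) {x : Q} (hx : x ∈ U) :
    D.Fiber x ≃ₗ[ℝ] EuclideanSpace ℝ (Fin r) :=
  (frameBasis h hx).equivFun ≪≫ₗ (WithLp.linearEquiv 2 ℝ (Fin r → ℝ)).symm

theorem fiberIncl_frameEquiv_symm (h : IsFrameOn D.space U e) {x : Q} (hx : x ∈ U)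
    (y : EuclideanSpace ℝ (Fin r)) :
    D.fiberIncl x ((frameEquiv h hx).symm y) = ∑ A, y A • e A x := by
  have h1 : (frameEquiv h hx).symm y = ∑ A, y A • frameBasis h hx A := by
    simp [frameEquiv, Module.Basis.equivFun_symm_apply]
  rw [h1, map_sum]
  refine Finset.sum_congr rfl fun A _ => ?_
  rw [map_smul]
  congr 1
  have h2 := congrArg Subtype.val (Module.Basis.span_apply (h.linearIndependent x hx) A)
  exact h2

open Classical in
/-- The local trivialization `(x, v) ↦ (x, y^A)` of the distribution defined by a frame. -/
def framePretrivialization (h : IsFrameOn D.space U e) :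
    Pretrivialization (EuclideanSpace ℝ (Fin r))
      (π (EuclideanSpace ℝ (Fin r)) D.Fiber) where
  toFun p := (p.1, if hx : p.1 ∈ U then frameEquiv h hx p.2 else 0)
  invFun q := ⟨q.1, if hx : q.1 ∈ U then (frameEquiv h hx).symm q.2 else 0⟩
  source := π (EuclideanSpace ℝ (Fin r)) D.Fiber ⁻¹' U
  target := U ×ˢ univ
  map_source' := fun p hp => ⟨hp, mem_univ _⟩
  map_target' := fun q hq => hq.1
  left_inv' := by
    rintro ⟨x, v⟩ hx
    have hx' : x ∈ U := hx
    simp [hx']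
  right_inv' := by
    rintro ⟨x, v⟩ hx
    have hx' : x ∈ U := hx.1
    simp [hx']
  open_target := h.isOpen.prod isOpen_univ
  baseSet := U
  open_baseSet := h.isOpen
  source_eq := rfl
  target_eq := rfl
  proj_toFun := fun _ _ => rfl

theorem framePretrivialization_apply (h : IsFrameOn D.space U e) {x : Q} (hx : x ∈ U)
    (v : D.Fiber x) : framePretrivialization h ⟨x, v⟩ = (x, frameEquiv h hx v) := by
  change (x, _) = (x, _)
  simp [hx]

theorem framePretrivialization_symm (h : IsFrameOn D.space U e) {x : Q} (hx : x ∈ U)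
    (y : EuclideanSpace ℝ (Fin r)) :
    (framePretrivialization h).symm x y = (frameEquiv h hx).symm y := by
  apply (frameEquiv h hx).injective
  have h1 := (framePretrivialization h).apply_mk_symm (b := x) hx y
  rw [framePretrivialization_apply h hx] at h1
  simpa using congrArg Prod.snd h1

theorem framePretrivialization_linear (h : IsFrameOn D.space U e) :
    (framePretrivialization h).IsLinear ℝ where
  linear := by
    intro x hx
    have hx' : x ∈ U := hx
    constructor
    · intro v w
      simp only [framePretrivialization_apply h hx', map_add]
    · intro c v
      simp only [framePretrivialization_apply h hx', map_smul]

variable {U' : Set Q} {e' : Fin r → ∀ y : Q, TangentSpace (𝓡 n) y}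

open Classical in
/-- The change of linear coordinates between two frames. -/
def frameChange (h : IsFrameOn D.space U e) (h' : IsFrameOn D.space U' e') (x : Q) :
    EuclideanSpace ℝ (Fin r) →L[ℝ] EuclideanSpace ℝ (Fin r) :=
  if hx : x ∈ U ∩ U' then
    LinearMap.toContinuousLinearMap
      ((frameEquiv h' hx.2).toLinearMap ∘ₗ (frameEquiv h hx.1).symm.toLinearMap)
  else 0

theorem frameChange_apply (h : IsFrameOn D.space U e) (h' : IsFrameOn D.space U' e') {x : Q}
    (hx : x ∈ U) (hx' : x ∈ U') (y : EuclideanSpace ℝ (Fin r)) :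
    frameChange h h' x y = frameEquiv h' hx' ((frameEquiv h hx).symm y) := by
  simp [frameChange, hx, hx']

/-- The frame read in the trivialization of the tangent bundle at `x₀`, as a matrix. -/
def frameMatrix (e : Fin r → ∀ y : Q, TangentSpace (𝓡 n) y) (x₀ x : Q) :
    EuclideanSpace ℝ (Fin r) →L[ℝ] EuclideanSpace ℝ (Fin n) :=
  ∑ A, (EuclideanSpace.proj A : EuclideanSpace ℝ (Fin r) →L[ℝ] ℝ).smulRight
    ((trivializationAt (EuclideanSpace ℝ (Fin n)) (TangentSpace (𝓡 n)) x₀) ⟨x, e A x⟩).2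

theorem frameMatrix_apply (h : IsFrameOn D.space U e) {x₀ x : Q} (hx : x ∈ U)
    (hx₀ : x ∈ (trivializationAt (EuclideanSpace ℝ (Fin n))
      (TangentSpace (𝓡 n) : Q → Type _) x₀).baseSet)
    (y : EuclideanSpace ℝ (Fin r)) :
    frameMatrix e x₀ x y = (trivializationAt (EuclideanSpace ℝ (Fin n)) (TangentSpace (𝓡 n))
      x₀).continuousLinearEquivAt ℝ x hx₀ (D.fiberIncl x ((frameEquiv h hx).symm y)) := by
  rw [fiberIncl_frameEquiv_symm h hx, map_sum]
  simp only [frameMatrix, sum_apply, ContinuousLinearMap.smulRight_apply,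
    map_smul]
  rfl

theorem contMDiffAt_frameMatrix (h : IsFrameOn D.space U e) {x₀ : Q} (hx : x₀ ∈ U) :
    ContMDiffAt (𝓡 n) 𝓘(ℝ, EuclideanSpace ℝ (Fin r) →L[ℝ] EuclideanSpace ℝ (Fin n)) ∞
      (frameMatrix e x₀) x₀ := by
  unfold frameMatrix
  refine ContMDiffAt.sum fun A _ => ?_
  have h1 : ContMDiffAt (𝓡 n) (𝓡 n).tangent ∞
      (fun x => (⟨x, e A x⟩ : TangentBundle (𝓡 n) Q)) x₀ :=
    (h.smooth A x₀ hx).contMDiffAt (h.isOpen.mem_nhds hx)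
  have h2 := (contMDiffAt_section x₀).1 h1
  exact ((ContinuousLinearMap.smulRightL ℝ (EuclideanSpace ℝ (Fin r)) (EuclideanSpace ℝ (Fin n))
    (EuclideanSpace.proj A)).contDiff (n := ∞)).contMDiff.contMDiffAt.comp x₀ h2

theorem contMDiffOn_frameChange (h : IsFrameOn D.space U e) (h' : IsFrameOn D.space U' e') :
    ContMDiffOn (𝓡 n) 𝓘(ℝ, EuclideanSpace ℝ (Fin r) →L[ℝ] EuclideanSpace ℝ (Fin r)) ∞
      (frameChange h h') (U ∩ U') := by
  intro x₀ hx₀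
  apply ContMDiffAt.contMDiffWithinAt
  set τ := trivializationAt (EuclideanSpace ℝ (Fin n)) (TangentSpace (𝓡 n) : Q → Type _) x₀
    with hτ
  have hb₀ : x₀ ∈ τ.baseSet := mem_baseSet_trivializationAt _ _ x₀
  have hinj : Function.Injective (frameMatrix e' x₀ x₀) := by
    intro y z hyz
    rw [frameMatrix_apply h' hx₀.2 hb₀, frameMatrix_apply h' hx₀.2 hb₀] at hyz
    have h1 := (ContinuousLinearEquiv.injective _) hyz
    exact (frameEquiv h' hx₀.2).symm.injective (Subtype.val_injective h1)
  obtain ⟨L₀, hL₀⟩ := LinearMap.exists_leftInverse_of_injective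
    (frameMatrix e' x₀ x₀).toLinearMap (LinearMap.ker_eq_bot.2 hinj)
  set L : EuclideanSpace ℝ (Fin n) →L[ℝ] EuclideanSpace ℝ (Fin r) :=
    LinearMap.toContinuousLinearMap L₀ with hL
  have hid : L.comp (frameMatrix e' x₀ x₀) = (ContinuousLinearEquiv.refl ℝ
      (EuclideanSpace ℝ (Fin r)) : _ →L[ℝ] _) := by
    ext1 y
    exact LinearMap.congr_fun hL₀ y
  have hcomp : ∀ {M : Q → EuclideanSpace ℝ (Fin r) →L[ℝ] EuclideanSpace ℝ (Fin n)},
      ContMDiffAt (𝓡 n) 𝓘(ℝ, EuclideanSpace ℝ (Fin r) →L[ℝ] EuclideanSpace ℝ (Fin n)) ∞ M x₀ →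
      ContMDiffAt (𝓡 n) 𝓘(ℝ, EuclideanSpace ℝ (Fin r) →L[ℝ] EuclideanSpace ℝ (Fin r)) ∞
        (fun x => L.comp (M x)) x₀ := fun hM => contMDiffAt_const.clm_comp hM
  have hA := hcomp (contMDiffAt_frameMatrix h' hx₀.2)
  have hB := hcomp (contMDiffAt_frameMatrix h hx₀.1)
  have hinv : ContMDiffAt (𝓡 n) 𝓘(ℝ, EuclideanSpace ℝ (Fin r) →L[ℝ] EuclideanSpace ℝ (Fin r)) ∞
      (fun x => ContinuousLinearMap.inverse (L.comp (frameMatrix e' x₀ x))) x₀ := by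
    have h1 : ContDiffAt ℝ ∞ ContinuousLinearMap.inverse (L.comp (frameMatrix e' x₀ x₀)) := by
      rw [hid]; exact contDiffAt_map_inverse _
    exact h1.contMDiffAt.comp x₀ hA
  refine (hinv.clm_comp hB).congr_of_eventuallyEq ?_
  have hopen : ∀ᶠ x in 𝓝 x₀, L.comp (frameMatrix e' x₀ x) ∈
      range ((↑) : (EuclideanSpace ℝ (Fin r) ≃L[ℝ] EuclideanSpace ℝ (Fin r)) → _ →L[ℝ] _) := by
    refine hA.continuousAt.eventually_mem (ContinuousLinearEquiv.isOpen.mem_nhds ?_)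
    exact ⟨_, hid.symm⟩
  filter_upwards [hopen, h.isOpen.mem_nhds hx₀.1, h'.isOpen.mem_nhds hx₀.2,
    τ.open_baseSet.mem_nhds hb₀] with x ⟨N, hN⟩ hx hx' hb
  have hkey : (L.comp (frameMatrix e' x₀ x)).comp (frameChange h h' x)
      = L.comp (frameMatrix e x₀ x) := by
    ext1 y
    simp only [ContinuousLinearMap.comp_apply]
    rw [frameMatrix_apply h' hx' hb, frameMatrix_apply h hx hb, frameChange_apply h h' hx hx',
      LinearEquiv.symm_apply_apply]
  rw [← hkey, ← hN, ContinuousLinearMap.inverse_equiv]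
  ext1 y
  simp

end Frame

/-- The vector bundle structure on a distribution: the local trivializations are the ones given by
all local frames. -/
def prebundle : VectorPrebundle ℝ (EuclideanSpace ℝ (Fin r)) D.Fiber where
  pretrivializationAtlas := {t | ∃ (U : Set Q) (e : Fin r → ∀ y : Q, TangentSpace (𝓡 n) y)
    (h : IsFrameOn D.space U e), t = framePretrivialization h}
  pretrivialization_linear' := by
    rintro _ ⟨U, e, h, rfl⟩
    exact framePretrivialization_linear h
  pretrivializationAt x :=
    framePretrivialization (D.exists_frame x).choose_spec.choose_spec.2
  mem_base_pretrivializationAt x := (D.exists_frame x).choose_spec.choose_spec.1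
  pretrivialization_mem_atlas x := ⟨_, _, _, rfl⟩
  exists_coordChange := by
    rintro _ ⟨U, e, h, rfl⟩ _ ⟨U', e', h', rfl⟩
    refine ⟨frameChange h h', (contMDiffOn_frameChange h h').continuousOn, ?_⟩
    rintro x ⟨hx, hx'⟩ v
    rw [framePretrivialization_symm h hx, framePretrivialization_apply h' hx',
      frameChange_apply h h' hx hx']
  totalSpaceMk_isInducing := by
    intro x
    have hx := (D.exists_frame x).choose_spec.choose_spec.1
    set h := (D.exists_frame x).choose_spec.choose_spec.2
    have h1 : (framePretrivialization h ∘ TotalSpace.mk x : D.Fiber x → _) =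
        (Prod.mk x) ∘ (frameEquiv h hx) := by
      funext v
      exact framePretrivialization_apply h hx v
    rw [h1]
    refine (isInducing_const_prod.2 Topology.IsInducing.id).comp ?_
    have : FiniteDimensional ℝ (D.Fiber x) :=
      (frameEquiv h hx).symm.finiteDimensional
    exact (frameEquiv h hx).toContinuousLinearEquiv.toHomeomorph.isInducing

instance : D.prebundle.IsContMDiff (𝓡 n) ∞ where
  exists_contMDiffCoordChange := by
    rintro _ ⟨U, e, h, rfl⟩ _ ⟨U', e', h', rfl⟩
    refine ⟨frameChange h h', contMDiffOn_frameChange h h', ?_⟩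
    rintro x ⟨hx, hx'⟩ v
    rw [framePretrivialization_symm h hx, framePretrivialization_apply h' hx',
      frameChange_apply h h' hx hx']

/-- The total space of the distribution. -/
abbrev Total : Type _ := TotalSpace (EuclideanSpace ℝ (Fin r)) D.Fiber

instance : TopologicalSpace D.Total := D.prebundle.totalSpaceTopology
instance : FiberBundle (EuclideanSpace ℝ (Fin r)) D.Fiber := D.prebundle.toFiberBundle
instance : VectorBundle ℝ (EuclideanSpace ℝ (Fin r)) D.Fiber := D.prebundle.toVectorBundle
instance : ContMDiffVectorBundle ∞ (EuclideanSpace ℝ (Fin r)) D.Fiber (𝓡 n) :=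
  D.prebundle.contMDiffVectorBundle (𝓡 n)

/-- The inclusion `j : D → TQ`. -/
def incl (p : D.Total) : TangentBundle (𝓡 n) Q := ⟨p.1, D.fiberIncl p.1 p.2⟩

end Distribution

end Distribution

/-! ### Submanifolds, their tangent vectors, and smooth functions on them -/

section Submanifold

variable {V : Type*} [NormedAddCommGroup V] [NormedSpace ℝ V] {H : Type*} [TopologicalSpace H]
  (J : ModelWithCorners ℝ V H) {M : Type*} [TopologicalSpace M] [ChartedSpace H M]

/-- The velocity vector `ċ(t)` of a curve, as an element of the tangent bundle. -/
def velocity (c : ℝ → M) (t : ℝ) : TangentBundle J M :=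
  ⟨c t, mfderiv 𝓘(ℝ, ℝ) J c t (1 : ℝ)⟩

/-- `S` is an embedded submanifold of dimension `d` of `M` (slice criterion): around every point of
`S` there is a smooth chart of `M` that maps `S` to a slice parallel to a `d`-dimensional
linear subspace of the model space. -/
def IsEmbeddedSubmanifold (S : Set M) (d : ℕ) : Prop :=
  ∀ p ∈ S, ∃ φ ∈ IsManifold.maximalAtlas J ∞ M, p ∈ φ.source ∧
    ∃ W : Submodule ℝ V, Module.finrank ℝ W = d ∧
      ∀ x ∈ φ.source, x ∈ S ↔ φ.extend J x - φ.extend J p ∈ W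

/-- `c` is a smooth curve near time `0` with values in the subset `S` of `M`. -/
def IsSmoothCurve {S : Set M} (c : ℝ → S) : Prop :=
  ∃ ε > 0, ContMDiffOn 𝓘(ℝ, ℝ) J ∞ (fun t => (c t : M)) (Ioo (-ε) ε)

/-- The tangent bundle `TS ⊆ TM` of a submanifold `S`: the velocities at time `0` of the smooth
curves in `S`. -/
def tangentVectors (S : Set M) : Set (TangentBundle J M) :=
  {w | ∃ c : ℝ → S, IsSmoothCurve J c ∧ velocity J (fun t => (c t : M)) 0 = w}

/-- A function on a submanifold `S` is smooth: it extends locally to smooth functions on open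
subsets of `M`. -/
def IsSmoothFunction {S : Set M} (f : S → ℝ) : Prop :=
  ∀ p : S, ∃ U : Set M, IsOpen U ∧ (p : M) ∈ U ∧ ∃ F : M → ℝ,
    ContMDiffOn J 𝓘(ℝ, ℝ) ∞ F U ∧ ∀ x : S, (x : M) ∈ U → F x = f x

/-- The restriction of the covector `μ` at `p` to `T_p S` is the differential `d f` of the function
`f` on `S`, that is, `⟨μ, ċ(0)⟩ = (f ∘ c)'(0)` for all smooth curves `c` in `S` through `p`. -/
def RestrictsToDifferential {S : Set M} (f : S → ℝ) (p : M) (μ : TangentSpace J p →L[ℝ] ℝ) : Prop :=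
  ∀ c : ℝ → S, IsSmoothCurve J c → ∀ v : TangentSpace J p,
    velocity J (fun t => (c t : M)) 0 = ⟨p, v⟩ → μ v = deriv (fun t => f (c t)) 0

/-! ### Exterior derivative of a one-form and Lagrangian submanifolds -/

/-- The one-form `θ` read in the preferred chart at `p`. -/
def oneFormInChart (θ : ∀ q : M, TangentSpace J q →L[ℝ] ℝ) (p : M) (y : V) : V →L[ℝ] ℝ :=
  (θ ((extChartAt J p).symm y)).comp
    (mfderivWithin 𝓘(ℝ, V) J (extChartAt J p).symm (range J) y)

/-- The exterior derivative `dθ` of a one-form at `p`, computed in the preferred chart at `p`: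
`dθ(u, v) = D_u θ (v) - D_v θ (u)`. -/
def extDerivOneForm (θ : ∀ q : M, TangentSpace J q →L[ℝ] ℝ) (p : M) (u v : TangentSpace J p) : ℝ :=
  let A : V →L[ℝ] V →L[ℝ] ℝ :=
    fderivWithin ℝ (oneFormInChart J θ p) (range J) (extChartAt J p p)
  let u' : V := mfderiv J 𝓘(ℝ, V) (extChartAt J p) p u
  let v' : V := mfderiv J 𝓘(ℝ, V) (extChartAt J p) p v
  A u' v' - A v' u'

/-- `S` is a Lagrangian submanifold of `(M, Ω)`: an embedded submanifold of half the dimension of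
`M` on which the two-form `Ω` pulls back to zero. -/
def IsLagrangianSubmanifold (Ω : ∀ p : M, TangentSpace J p → TangentSpace J p → ℝ)
    (S : Set M) : Prop :=
  (∃ d : ℕ, 2 * d = Module.finrank ℝ V ∧ IsEmbeddedSubmanifold J S d) ∧
    ∀ p ∈ S, ∀ u v : TangentSpace J p, (⟨p, u⟩ : TangentBundle J M) ∈ tangentVectors J S →
      (⟨p, v⟩ : TangentBundle J M) ∈ tangentVectors J S → Ω p u v = 0

end Submanifold

/-! ### The cotangent bundle with its canonical symplectic form -/

section Cotangent

variable {V : Type*} [NormedAddCommGroup V] [NormedSpace ℝ V] {H : Type*} [TopologicalSpace H]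
  (J : ModelWithCorners ℝ V H) (M : Type*) [TopologicalSpace M] [ChartedSpace H M]

/-- The cotangent bundle `T*M`, with Mathlib's smooth structure on bundles of linear maps. -/
abbrev CotangentBundle : Type _ :=
  TotalSpace (V →L[ℝ] ℝ) (fun p : M => TangentSpace J p →L[ℝ] ℝ)

/-- The model with corners of the cotangent bundle. -/
abbrev cotangentModel : ModelWithCorners ℝ (V × (V →L[ℝ] ℝ)) (ModelProd H (V →L[ℝ] ℝ)) :=
  J.prod 𝓘(ℝ, V →L[ℝ] ℝ)

variable {M} [IsManifold J 1 M]

/-- The Liouville one-form `θ_μ(X) = ⟨μ, Tπ(X)⟩`. -/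
def liouvilleForm (μ : CotangentBundle J M) : TangentSpace (cotangentModel J) μ →L[ℝ] ℝ :=
  ContinuousLinearMap.comp (M₂ := TangentSpace J μ.1) μ.2
    (mfderiv (cotangentModel J) J (fun ν : CotangentBundle J M => ν.1) μ)

/-- The canonical symplectic form `ω = -dθ` of the cotangent bundle. -/
def canonicalForm (μ : CotangentBundle J M) (X Y : TangentSpace (cotangentModel J) μ) : ℝ :=
  -extDerivOneForm (cotangentModel J) (liouvilleForm J) μ X Y

/-- The subset `Σ_f` of `T*M` generated by a function `f` on a submanifold `S` of `M`: the
covectors at points of `S` whose restriction to `TS` is `d f`. -/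
def generatedSet {S : Set M} (f : S → ℝ) : Set (CotangentBundle J M) :=
  {μ | μ.1 ∈ S ∧ RestrictsToDifferential J f μ.1 μ.2}

end Cotangent

/-! ### Admissible curves and the set `D^(2)` -/

namespace Distribution

variable {n r : ℕ} {Q : Type*} [TopologicalSpace Q] [ChartedSpace (EuclideanSpace ℝ (Fin n)) Q]
  [IsManifold (𝓡 n) ∞ Q] (D : Distribution n Q r)

/-- The model with corners of the total space of a distribution of rank `r`. -/
abbrev totalModel (n r : ℕ) := (𝓡 n).prod (𝓡 r)

/-- A smooth curve `γ : I → D` is admissible if it is the velocity of its projection `σ` to `Q`. -/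
def IsAdmissible (γ : ℝ → D.Total) (I : Set ℝ) : Prop :=
  ContMDiffOn 𝓘(ℝ, ℝ) (totalModel n r) ∞ γ I ∧
    ∃ σ : ℝ → Q, (∀ t ∈ I, (γ t).1 = σ t) ∧ ∀ t ∈ I, D.incl (γ t) = velocity (𝓡 n) σ t

/-- The set `D^(2) ⊆ TD` of the tangent vectors to admissible curves. -/
def second : Set (TangentBundle (totalModel n r) D.Total) :=
  {v | ∃ ε > 0, ∃ γ : ℝ → D.Total, D.IsAdmissible γ (Ioo (-ε) ε) ∧
    v = velocity (totalModel n r) γ 0}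

end Distribution

end LagrangianSigma

end

open LagrangianSigma

/-!
Two facts about local charts carry the proof.

The first concerns an arbitrary manifold `M` without boundary, an embedded submanifold `S` and a
smooth function `f` on `S`. A straightening `Ψ` of `S` in a chart identifies `S` with a slice
parallel to a linear subspace `W`, and `f` is locally the restriction of a smooth function `F`. In
canonical coordinates `(y, l)` of `T*M`, the generated set is given by the conditions that `y` lies on the
submanifold and that `l - dF(y)` vanishes on its tangent space
(`IsStraightening.mem_generatedSet_iff`). Hence the fibre translation by `-dF` followed by the
cotangent lift of `Ψ` maps it to a slice parallel to `W × W⁰`, with `W⁰` the annihilator of `W`; the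
dimension of this slice is `dim W + (dim M - dim W) = dim M`
(`isEmbeddedSubmanifold_generatedSet`). The Liouville form is `p dq` in canonical coordinates, so
`ω((a, α), (b, β)) = ⟨β, a⟩ - ⟨α, b⟩` (`canonicalForm_eq`). Differentiating the equation
`(l - dF(y)) (DΨ⁻¹ w) = 0`, `w ∈ W`, along a curve with velocity `(a, α)` shows that
`⟨α, b⟩ = B(a, b)` on vectors tangent to `S`, where `B` is built from the second derivatives of
`F` and `Ψ⁻¹` and is therefore symmetric (`IsStraightening.exists_symmetric`). So `ω` vanishes on
tangent vectors of the generated set.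

The second concerns the distribution `D`: the set `D^(2)` consists of the vectors `v` with
`Tτ(v) = j(π(v))` (`Distribution.mem_second_iff`). Velocities of admissible curves satisfy this
equation by the chain rule. Conversely, with `ẋ = f(x, y)` the equation in charts, the integral
curve of the vector field `(f(x, y), ẏ)`, for fixed `ẏ`, through the base point of `v` is
admissible and has velocity `v`; it is smooth because the vector field is. The shear
`(x, y, ẋ, ẏ) ↦ (x, y, ẋ - f(x, y), ẏ)` straightens `D^(2)` to a linear subspace of codimension `n`
in dimension `2(n + r)` (`Distribution.isEmbeddedSubmanifold_second`).
-/

noncomputable section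

namespace LagrangianSigma

/-! ### Straightening of embedded submanifolds in the preferred charts -/

section Straightening

variable {V : Type*} [NormedAddCommGroup V] [NormedSpace ℝ V] {H : Type*} [TopologicalSpace H]
  {J : ModelWithCorners ℝ V H} {M : Type*} [TopologicalSpace M] [ChartedSpace H M]

variable (J) in
/-- The local diffeomorphism `Ψ` of the model space `V`, defined on part of the preferred chart at
`p`, maps the subset `S`, read in this chart, to the slice parallel to `W` through the image
of `p`. -/
structure IsStraightening (S : Set M) (p : M) (Ψ : OpenPartialHomeomorph V V)
    (W : Submodule ℝ V) : Prop where
  contDiffOn : ContDiffOn ℝ ∞ Ψ Ψ.source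
  contDiffOn_symm : ContDiffOn ℝ ∞ Ψ.symm Ψ.target
  mem_source : extChartAt J p p ∈ Ψ.source
  source_subset : Ψ.source ⊆ (extChartAt J p).target
  mem_iff : ∀ y ∈ Ψ.source, (extChartAt J p).symm y ∈ S ↔ Ψ y - Ψ (extChartAt J p p) ∈ W

namespace IsStraightening

variable {S : Set M} {p : M} {Ψ : OpenPartialHomeomorph V V} {W : Submodule ℝ V}

theorem restr (h : IsStraightening J S p Ψ W) {U : Set V} (hU : IsOpen U)
    (hp : extChartAt J p p ∈ U) : IsStraightening J S p (Ψ.restrOpen U hU) W where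
  contDiffOn := h.contDiffOn.mono inter_subset_left
  contDiffOn_symm := h.contDiffOn_symm.mono inter_subset_left
  mem_source := ⟨h.mem_source, hp⟩
  source_subset := inter_subset_left.trans h.source_subset
  mem_iff y hy := h.mem_iff y hy.1

theorem fderiv_symm_comp_fderiv (h : IsStraightening J S p Ψ W) {y : V} (hy : y ∈ Ψ.source)
    (v : V) : fderiv ℝ Ψ.symm (Ψ y) (fderiv ℝ Ψ y v) = v := by
  have h1 : HasFDerivAt Ψ (fderiv ℝ Ψ y) y :=
    ((h.contDiffOn.differentiableOn (by simp)).differentiableAt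
      (Ψ.open_source.mem_nhds hy)).hasFDerivAt
  have h2 : HasFDerivAt Ψ.symm (fderiv ℝ Ψ.symm (Ψ y)) (Ψ y) :=
    ((h.contDiffOn_symm.differentiableOn (by simp)).differentiableAt
      (Ψ.open_target.mem_nhds (Ψ.map_source hy))).hasFDerivAt
  have h3 := (h2.comp y h1).congr_of_eventuallyEq (f₁ := id) (by
    filter_upwards [Ψ.open_source.mem_nhds hy] with z hz
    exact (Ψ.left_inv hz).symm)
  exact (DFunLike.congr_fun (h3.unique (hasFDerivAt_id y)) v)

theorem fderiv_comp_fderiv_symm (h : IsStraightening J S p Ψ W) {y : V} (hy : y ∈ Ψ.source)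
    (v : V) : fderiv ℝ Ψ y (fderiv ℝ Ψ.symm (Ψ y) v) = v := by
  have h1 : HasFDerivAt Ψ (fderiv ℝ Ψ (Ψ.symm (Ψ y))) (Ψ.symm (Ψ y)) := by
    rw [Ψ.left_inv hy]
    exact ((h.contDiffOn.differentiableOn (by simp)).differentiableAt
      (Ψ.open_source.mem_nhds hy)).hasFDerivAt
  have h2 : HasFDerivAt Ψ.symm (fderiv ℝ Ψ.symm (Ψ y)) (Ψ y) :=
    ((h.contDiffOn_symm.differentiableOn (by simp)).differentiableAt
      (Ψ.open_target.mem_nhds (Ψ.map_source hy))).hasFDerivAt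
  have h3 := (h1.comp (Ψ y) h2).congr_of_eventuallyEq (f₁ := id) (by
    filter_upwards [Ψ.open_target.mem_nhds (Ψ.map_source hy)] with z hz
    exact (Ψ.right_inv hz).symm)
  have h4 := DFunLike.congr_fun (h3.unique (hasFDerivAt_id (Ψ y))) v
  rw [Ψ.left_inv hy] at h4
  exact h4

end IsStraightening

/-- The slice criterion can be checked in the preferred charts. -/
theorem isEmbeddedSubmanifold_iff [J.Boundaryless] [IsManifold J ∞ M] {S : Set M} {d : ℕ} :
    IsEmbeddedSubmanifold J S d ↔ ∀ p ∈ S, ∃ (Ψ : OpenPartialHomeomorph V V) (W : Submodule ℝ V),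
      IsStraightening J S p Ψ W ∧ Module.finrank ℝ W = d := by
  constructor
  · intro h p hp
    obtain ⟨φ, hφ, hpφ, W, hW, hS⟩ := h p hp
    have hJ : ∀ y, J (J.symm y) = y := fun y => J.right_inv (by simp [J.range_eq_univ])
    let Ψ : OpenPartialHomeomorph V V := J.toHomeomorph.symm.toOpenPartialHomeomorph.trans
      (((chartAt H p).symm.trans φ).trans J.toHomeomorph.toOpenPartialHomeomorph)
    have hΨ : ∀ y, Ψ y = φ.extend J ((extChartAt J p).symm y) := fun y => rfl
    have hsrc : ∀ y, y ∈ Ψ.source ↔ y ∈ (extChartAt J p).target ∧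
        (extChartAt J p).symm y ∈ φ.source := by
      intro y
      simp [Ψ, J.range_eq_univ]
    have hgr := (contDiffGroupoid ∞ J).compatible_of_mem_maximalAtlas
      (IsManifold.chart_mem_maximalAtlas p : chartAt H p ∈ IsManifold.maximalAtlas J ∞ M) hφ
    rw [contDiffGroupoid, mem_groupoid_of_pregroupoid] at hgr
    refine ⟨Ψ, W, ⟨?_, ?_, ?_, ?_, ?_⟩, hW⟩
    · refine ContDiffOn.mono hgr.1 ?_
      intro y hy
      simpa [Ψ, J.range_eq_univ] using! hy
    · refine ContDiffOn.mono hgr.2 ?_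
      intro y hy
      simpa [Ψ, J.range_eq_univ] using! hy
    · rw [hsrc]
      simp [hpφ]
    · intro y hy
      exact ((hsrc y).1 hy).1
    · intro y hy
      rw [hS _ ((hsrc y).1 hy).2, hΨ, hΨ, extChartAt_to_inv]
  · intro h p hp
    obtain ⟨Ψ, W, hΨ, hW⟩ := h p hp
    let φ : OpenPartialHomeomorph M H := (chartAt H p).trans
      (J.toHomeomorph.toOpenPartialHomeomorph.trans
        (Ψ.trans J.toHomeomorph.symm.toOpenPartialHomeomorph))
    have hsrc : ∀ x, x ∈ φ.source ↔ x ∈ (extChartAt J p).source ∧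
        extChartAt J p x ∈ Ψ.source := by
      intro x
      simp [φ]
    have hext : ∀ x, φ.extend J x = Ψ (extChartAt J p x) :=
      fun x => J.right_inv (by simp [J.range_eq_univ])
    refine ⟨φ, ?_, ?_, W, hW, ?_⟩
    · apply OpenPartialHomeomorph.mem_maximalAtlas_of_contMDiffOn
      · have h1 : ContMDiffOn J 𝓘(ℝ, V) ∞ (Ψ ∘ extChartAt J p) φ.source :=
          hΨ.contDiffOn.contMDiffOn.comp (contMDiffOn_extChartAt.mono fun x hx => by
            simpa using ((hsrc x).1 hx).1) fun x hx => ((hsrc x).1 hx).2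
        exact (J.contMDiffOn_symm.comp h1 fun x _ => by simp [J.range_eq_univ])
      · have h1 : ContMDiffOn J 𝓘(ℝ, V) ∞ (Ψ.symm ∘ J) φ.target :=
          hΨ.contDiffOn_symm.contMDiffOn.comp J.contMDiff.contMDiffOn fun x hx => by
            simp [φ] at hx
            exact hx.1
        refine (contMDiffOn_extChartAt_symm p).comp h1 fun x hx => hΨ.source_subset ?_
        apply Ψ.map_target
        simp [φ] at hx
        exact hx.1
    · rw [hsrc]
      exact ⟨mem_extChartAt_source p, hΨ.mem_source⟩
    · intro x hx
      obtain ⟨h1, h2⟩ := (hsrc x).1 hx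
      rw [hext, hext, ← hΨ.mem_iff _ h2, (extChartAt J p).left_inv h1]

/-- The velocity of a curve in an affine subspace lies in its direction, which is closed. -/
theorem hasDerivAt_mem_of_eventually_sub_mem [FiniteDimensional ℝ V] {W : Submodule ℝ V}
    {g : ℝ → V} {g' a : V} {t : ℝ} (hg : HasDerivAt g g' t) (h : ∀ᶠ s in 𝓝 t, g s - a ∈ W) :
    g' ∈ W := by
  refine W.closed_of_finiteDimensional.mem_of_tendsto (hasDerivAt_iff_tendsto_slope.1 hg) ?_
  filter_upwards [nhdsWithin_le_nhds h] with s hs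
  rw [slope_def_module]
  refine W.smul_mem _ ?_
  have := W.sub_mem hs h.self_of_nhds
  simpa using this

end Straightening

/-! ### Velocities in charts -/

section Velocity

variable {V : Type*} [NormedAddCommGroup V] [NormedSpace ℝ V] {H : Type*} [TopologicalSpace H]
  {J : ModelWithCorners ℝ V H} {M : Type*} [TopologicalSpace M] [ChartedSpace H M]

theorem exists_velocity_eq {c : ℝ → M} {t : ℝ} {q : M} (h : c t = q) :
    ∃ v : TangentSpace J q, velocity J c t = ⟨q, v⟩ := by
  subst h
  exact ⟨_, rfl⟩

/-- The velocity `⟨q, v⟩` is given with its base point as a free variable, so that it can be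
compared with vectors at a point known only to be equal to `c t`. -/
theorem hasDerivAt_extChartAt_comp [IsManifold J 1 M] {c : ℝ → M} {t : ℝ} {p q : M}
    {v : TangentSpace J q} (hc : MDifferentiableAt 𝓘(ℝ, ℝ) J c t)
    (hv : velocity J c t = ⟨q, v⟩) (hq : q ∈ (extChartAt J p).source) :
    HasDerivAt (fun s => extChartAt J p (c s)) (mfderiv J 𝓘(ℝ, V) (extChartAt J p) q v) t := by
  cases hv
  have h1 := (mdifferentiableAt_extChartAt (I := J) (by simpa using hq)).hasMFDerivAt.comp t
    hc.hasMFDerivAt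
  let A : ℝ →L[ℝ] V :=
    (mfderiv J 𝓘(ℝ, V) (extChartAt J p) (c t)).comp (mfderiv 𝓘(ℝ, ℝ) J c t)
  have h2 : HasFDerivAt (fun s => extChartAt J p (c s)) A t := h1.hasFDerivAt
  exact h2.hasDerivAt

theorem eventually_mem_extChartAt_source {c : ℝ → M} {t : ℝ} {p q : M}
    {v : TangentSpace J q} (hc : MDifferentiableAt 𝓘(ℝ, ℝ) J c t)
    (hv : velocity J c t = ⟨q, v⟩) (hq : q ∈ (extChartAt J p).source) :
    ∀ᶠ s in 𝓝 t, c s ∈ (extChartAt J p).source := by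
  cases hv
  exact hc.continuousAt.eventually_mem (extChartAt_source_mem_nhds' hq)

end Velocity

/-! ### The canonical symplectic form in canonical coordinates -/

/-- The derivative of the one-form `p dq`, for a pairing `B` of `p` with `dq`. -/
theorem fderiv_apply_of_eventuallyEq_pairing {V W : Type*} [NormedAddCommGroup V]
    [NormedSpace ℝ V] [NormedAddCommGroup W] [NormedSpace ℝ W] (B : W →L[ℝ] V →L[ℝ] ℝ)
    {g : V × W → V × W →L[ℝ] ℝ} {x : V × W}
    (h : ∀ᶠ y in 𝓝 x, g y = (B y.2).comp (ContinuousLinearMap.fst ℝ V W)) (a b : V × W) :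
    fderiv ℝ g x a b = B a.2 b.1 := by
  let Λ : V × W →L[ℝ] V × W →L[ℝ] ℝ :=
    ((ContinuousLinearMap.compL ℝ (V × W) V ℝ).flip (ContinuousLinearMap.fst ℝ V W)).comp
      (B.comp (ContinuousLinearMap.snd ℝ V W))
  have hΛ : HasFDerivAt Λ Λ x := Λ.hasFDerivAt
  rw [(hΛ.congr_of_eventuallyEq h).fderiv]
  rfl

section CotangentChart

variable {V : Type*} [NormedAddCommGroup V] [NormedSpace ℝ V] {H : Type*} [TopologicalSpace H]
  {J : ModelWithCorners ℝ V H} {M : Type*} [TopologicalSpace M] [ChartedSpace H M]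
  [IsManifold J ∞ M]

theorem cotangent_extChartAt_source (μ : CotangentBundle J M) :
    (extChartAt (cotangentModel J) μ).source =
      {ν : CotangentBundle J M | ν.1 ∈ (extChartAt J μ.1).source} := by
  rw [FiberBundle.extChartAt]
  ext ν
  have h1 : ν ∈ (trivializationAt (V →L[ℝ] ℝ) (fun x => TangentSpace J x →L[ℝ] ℝ) μ.1).source ↔
      ν.1 ∈ (chartAt H μ.1).source := by
    rw [hom_trivializationAt_source]
    simp
  rw [PartialEquiv.trans_source, mem_inter_iff]
  refine (and_congr_left' h1).trans ?_
  simp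
  intro h
  exact h

theorem cotangent_extChartAt_target (μ : CotangentBundle J M) :
    (extChartAt (cotangentModel J) μ).target = (extChartAt J μ.1).target ×ˢ univ := by
  rw [FiberBundle.extChartAt_target]
  congr 1
  refine inter_eq_left.2 fun y hy => ?_
  rw [hom_trivializationAt_baseSet]
  simpa using (extChartAt J μ.1).map_target hy

theorem cotangent_extChartAt_fst (μ ν : CotangentBundle J M) :
    (extChartAt (cotangentModel J) μ ν).1 = extChartAt J μ.1 ν.1 := by
  rw [FiberBundle.extChartAt]
  rfl

/-- The fibre coordinate `p` of a covector is its push-forward along the chart of the base. -/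
theorem cotangent_extChartAt_snd (μ ν : CotangentBundle J M)
    (h : ν.1 ∈ (extChartAt J μ.1).source) (v : TangentSpace J ν.1) :
    (extChartAt (cotangentModel J) μ ν).2 (mfderiv J 𝓘(ℝ, V) (extChartAt J μ.1) ν.1 v) =
      ν.2 v := by
  have hb : ν.1 ∈ (trivializationAt V (TangentSpace J : M → Type _) μ.1).baseSet := by
    simpa using h
  have h1 : (extChartAt (cotangentModel J) μ ν).2 =
     ν.2.comp ((trivializationAt V (TangentSpace J) μ.1).symmL ℝ ν.1) := by
    rw [FiberBundle.extChartAt]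
    change (trivializationAt (V →L[ℝ] ℝ) (fun x => TangentSpace J x →L[ℝ] ℝ) μ.1 ν).2 = _
    rw [hom_trivializationAt_apply]
    change ContinuousLinearMap.inCoordinates V (TangentSpace J) ℝ (fun _ => ℝ)
      μ.1 ν.1 μ.1 ν.1 ν.2 = _
    ext w
    simp [ContinuousLinearMap.inCoordinates]
  rw [h1, ← TangentBundle.continuousLinearMapAt_trivializationAt (by simpa using h)]
  exact congrArg ν.2 (Trivialization.symmL_continuousLinearMapAt _ hb v)


/-- In the canonical coordinates `(q, p)` the Liouville form is `p dq`. -/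
theorem oneFormInChart_liouvilleForm [J.Boundaryless] (μ : CotangentBundle J M)
    {y : V × (V →L[ℝ] ℝ)} (hy : y ∈ (extChartAt (cotangentModel J) μ).target) :
    oneFormInChart (cotangentModel J) (liouvilleForm J) μ y =
      y.2.comp (ContinuousLinearMap.fst ℝ V (V →L[ℝ] ℝ)) := by
  set χ := extChartAt (cotangentModel J) μ with hχ
  set ν := χ.symm y with hν
  have hνs : ν ∈ χ.source := χ.map_target hy
  have hν1 : ν.1 ∈ (extChartAt J μ.1).source := by
    rw [hχ, cotangent_extChartAt_source] at hνs
    exact hνs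
  have hχν : χ ν = y := χ.right_inv hy
  have h1 : HasMFDerivAt 𝓘(ℝ, V × (V →L[ℝ] ℝ)) (cotangentModel J) χ.symm y
      (mfderivWithin 𝓘(ℝ, V × (V →L[ℝ] ℝ)) (cotangentModel J) χ.symm
        (range (cotangentModel J)) y) := by
    have h := (mdifferentiableWithinAt_extChartAt_symm (I := cotangentModel J) hy)
    have := h.hasMFDerivWithinAt
    rw [ModelWithCorners.range_eq_univ] at this ⊢
    exact hasMFDerivWithinAt_univ.1 this
  have h2 : HasMFDerivAt (cotangentModel J) J (fun ν : CotangentBundle J M => ν.1) ν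
      (mfderiv (cotangentModel J) J (fun ν : CotangentBundle J M => ν.1) ν) :=
    ((contMDiff_proj (n := 1) (IB := J) (F := V →L[ℝ] ℝ)
      (fun p : M => TangentSpace J p →L[ℝ] ℝ)).mdifferentiable (by simp) ν).hasMFDerivAt
  have h3 : HasMFDerivAt J 𝓘(ℝ, V) (extChartAt J μ.1) ν.1
      (mfderiv J 𝓘(ℝ, V) (extChartAt J μ.1) ν.1) :=
    (mdifferentiableAt_extChartAt (by simpa using hν1)).hasMFDerivAt
  have h4 := h3.comp y (h2.comp y h1)
  -- the projection to the base is the first projection in the canonical coordinates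
  have h5 := h4.congr_of_eventuallyEq (f₁ := Prod.fst) (by
    filter_upwards [(isOpen_extChartAt_target μ).mem_nhds hy] with z hz
    change z.1 = extChartAt J μ.1 (χ.symm z).1
    rw [← cotangent_extChartAt_fst, ← hχ, χ.right_inv hz])
  have h6 := hasMFDerivAt_unique h5 (hasFDerivAt_fst (𝕜 := ℝ) (p := y)).hasMFDerivAt
  refine ContinuousLinearMap.ext fun a => ?_
  have h7 := DFunLike.congr_fun h6 a
  have h8 := cotangent_extChartAt_snd μ ν hν1 (mfderiv (cotangentModel J) J
    (fun ν : CotangentBundle J M => ν.1) ν (mfderivWithin 𝓘(ℝ, V × (V →L[ℝ] ℝ))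
      (cotangentModel J) χ.symm (range (cotangentModel J)) y a))
  rw [← hχ, hχν] at h8
  refine Eq.trans h8.symm ?_
  exact congrArg y.2 h7

/-- In the canonical coordinates `(q, p)` the symplectic form is `dq ∧ dp`. -/
theorem canonicalForm_eq [J.Boundaryless] (μ : CotangentBundle J M)
    (X Y : TangentSpace (cotangentModel J) μ) {x y : V × (V →L[ℝ] ℝ)}
    (hX : mfderiv (cotangentModel J) 𝓘(ℝ, V × (V →L[ℝ] ℝ))
      (extChartAt (cotangentModel J) μ) μ X = x)
    (hY : mfderiv (cotangentModel J) 𝓘(ℝ, V × (V →L[ℝ] ℝ))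
      (extChartAt (cotangentModel J) μ) μ Y = y) :
    canonicalForm J μ X Y = y.2 x.1 - x.2 y.1 := by
  have h1 (a b : V × (V →L[ℝ] ℝ)) :
      fderivWithin ℝ (oneFormInChart (cotangentModel J) (liouvilleForm J) μ)
      (range (cotangentModel J)) (extChartAt (cotangentModel J) μ μ) a b = a.2 b.1 := by
    rw [ModelWithCorners.range_eq_univ, fderivWithin_univ]
    refine fderiv_apply_of_eventuallyEq_pairing (ContinuousLinearMap.id ℝ (V →L[ℝ] ℝ)) ?_ a b
    filter_upwards [extChartAt_target_mem_nhds (I := cotangentModel J) μ] with z hz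
    exact oneFormInChart_liouvilleForm μ hz
  rw [canonicalForm, extDerivOneForm, hX, hY]
  simp only [h1, neg_sub]

end CotangentChart

/-! ### The set generated by a function, in canonical coordinates -/

section GeneratedSet

variable {V : Type*} [NormedAddCommGroup V] [NormedSpace ℝ V] {H : Type*} [TopologicalSpace H]
  {J : ModelWithCorners ℝ V H} {M : Type*} [TopologicalSpace M] [ChartedSpace H M]
  [IsManifold J ∞ M] {S : Set M} {p : M} {Ψ : OpenPartialHomeomorph V V} {W : Submodule ℝ V}

omit [IsManifold J ∞ M] in
theorem IsSmoothCurve.mdifferentiableAt {c : ℝ → S} (hc : IsSmoothCurve J c) :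
    MDifferentiableAt 𝓘(ℝ, ℝ) J (fun t => (c t : M)) 0 := by
  obtain ⟨ε, hε, h⟩ := hc
  exact (h.contMDiffAt (Ioo_mem_nhds (by simpa using hε) hε)).mdifferentiableAt (by simp)

/-- Every vector of the slice is realized by the straight line in the slice. -/
theorem IsStraightening.exists_isSmoothCurve (h : IsStraightening J S p Ψ W) {q : M} (hq : q ∈ S)
    (hqp : q ∈ (extChartAt J p).source) (hqΨ : extChartAt J p q ∈ Ψ.source) {w : V} (hw : w ∈ W) :
    ∃ c : ℝ → S, IsSmoothCurve J c ∧
      (∀ᶠ t in 𝓝 (0 : ℝ), extChartAt J p (c t) = Ψ.symm (Ψ (extChartAt J p q) + t • w)) ∧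
      ∃ v : TangentSpace J q, velocity J (fun t => (c t : M)) 0 = ⟨q, v⟩ ∧
        mfderiv J 𝓘(ℝ, V) (extChartAt J p) q v =
          fderiv ℝ Ψ.symm (Ψ (extChartAt J p q)) w := by
  classical
  set ψ := extChartAt J p with hψ
  have hline : ContDiff ℝ ∞ (fun t : ℝ => Ψ (ψ q) + t • w) := by fun_prop
  let c₀ : ℝ → M := fun t => ψ.symm (Ψ.symm (Ψ (ψ q) + t • w))
  -- away from time `0` the line may leave the chart, and the curve is continued by a constant
  let c : ℝ → S := fun t => if ht : c₀ t ∈ S then ⟨c₀ t, ht⟩ else ⟨q, hq⟩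
  have hN : ∀ᶠ t in 𝓝 (0 : ℝ), Ψ (ψ q) + t • w ∈ Ψ.target := by
    refine hline.continuous.continuousAt.eventually_mem (Ψ.open_target.mem_nhds ?_)
    simpa using Ψ.map_source hqΨ
  obtain ⟨ε, hε, hball⟩ := Metric.eventually_nhds_iff_ball.1 hN
  have hIoo : ∀ t ∈ Ioo (-ε) ε, Ψ (ψ q) + t • w ∈ Ψ.target := fun t ht =>
    hball t (by rw [Real.ball_eq_Ioo]; simpa using ht)
  have hnhds : Ioo (-ε) ε ∈ 𝓝 (0 : ℝ) := Ioo_mem_nhds (by simpa using hε) hε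
  have hcc : ∀ t ∈ Ioo (-ε) ε, (c t : M) = c₀ t := by
    intro t ht
    have h1 : c₀ t ∈ S := by
      rw [h.mem_iff _ (Ψ.map_target (hIoo t ht)), Ψ.right_inv (hIoo t ht), add_sub_right_comm]
      refine W.add_mem ?_ (W.smul_mem _ hw)
      rw [← h.mem_iff _ hqΨ, ← hψ, ψ.left_inv hqp]
      exact hq
    simp [c, h1]
  have hc : IsSmoothCurve J c := by
    refine ⟨ε, hε, ContMDiffOn.congr ?_ hcc⟩
    refine (contMDiffOn_extChartAt_symm p).comp
      (h.contDiffOn_symm.comp hline.contDiffOn hIoo).contMDiffOn fun t ht => ?_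
    exact h.source_subset (Ψ.map_target (hIoo t ht))
  have hψc : ∀ᶠ t in 𝓝 (0 : ℝ), ψ (c t) = Ψ.symm (Ψ (ψ q) + t • w) := by
    filter_upwards [hnhds] with t ht
    rw [hcc t ht]
    exact ψ.right_inv (h.source_subset (Ψ.map_target (hIoo t ht)))
  refine ⟨c, hc, hψc, ?_⟩
  have h0 : (c 0 : M) = q := by
    rw [hcc 0 (mem_of_mem_nhds hnhds)]
    simp [c₀, Ψ.left_inv hqΨ, ψ.left_inv hqp]
  obtain ⟨v, hv⟩ := exists_velocity_eq (J := J) (c := fun t => (c t : M)) h0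
  refine ⟨v, hv, ?_⟩
  have h1 := hasDerivAt_extChartAt_comp hc.mdifferentiableAt hv hqp
  have h2 : HasDerivAt (fun t : ℝ => Ψ.symm (Ψ (ψ q) + t • w))
      (fderiv ℝ Ψ.symm (Ψ (ψ q)) w) 0 := by
    have h3 : HasDerivAt (fun t : ℝ => Ψ (ψ q) + t • w) w 0 := by
      simpa using ((hasDerivAt_id (0 : ℝ)).smul_const w).const_add (Ψ (ψ q))
    have h4 : HasFDerivAt Ψ.symm (fderiv ℝ Ψ.symm (Ψ (ψ q))) (Ψ (ψ q) + (0 : ℝ) • w) := by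
      rw [zero_smul, add_zero]
      exact ((h.contDiffOn_symm.differentiableOn (by simp)).differentiableAt
        (Ψ.open_target.mem_nhds (Ψ.map_source hqΨ))).hasFDerivAt
    exact h4.comp_hasDerivAt 0 h3
  exact h1.unique (h2.congr_of_eventuallyEq hψc)

/-- A straightening can be chosen on whose domain a given smooth function on the submanifold is
the restriction of a smooth function. -/
theorem IsEmbeddedSubmanifold.exists_isStraightening_of_isSmoothFunction [J.Boundaryless] {d : ℕ}
    (hS : IsEmbeddedSubmanifold J S d) {f : S → ℝ} (hf : IsSmoothFunction J f) (hp : p ∈ S) :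
    ∃ (Ψ : OpenPartialHomeomorph V V) (W : Submodule ℝ V) (F : V → ℝ),
      IsStraightening J S p Ψ W ∧ Module.finrank ℝ W = d ∧ ContDiffOn ℝ ∞ F Ψ.source ∧
      ∀ x : S, (x : M) ∈ (extChartAt J p).source → extChartAt J p x ∈ Ψ.source →
        f x = F (extChartAt J p x) := by
  obtain ⟨Ψ, W, hΨ, hW⟩ := isEmbeddedSubmanifold_iff.1 hS p hp
  obtain ⟨U, hU, hpU, F, hF, hFf⟩ := hf ⟨p, hp⟩
  let U' : Set V := (extChartAt J p).target ∩ (extChartAt J p).symm ⁻¹' U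
  have hU' : IsOpen U' :=
    (continuousOn_extChartAt_symm p).isOpen_inter_preimage (isOpen_extChartAt_target p) hU
  refine ⟨Ψ.restrOpen U' hU', W, F ∘ (extChartAt J p).symm,
    hΨ.restr hU' ⟨mem_extChartAt_target p, ?_⟩, hW, ?_, ?_⟩
  · rwa [mem_preimage, extChartAt_to_inv]
  · rw [← contMDiffOn_iff_contDiffOn]
    exact hF.comp ((contMDiffOn_extChartAt_symm p).mono fun y hy => hy.2.1) fun y hy => hy.2.2
  · intro x hx hxΨ
    have h1 := hxΨ.2.2
    rw [mem_preimage, (extChartAt J p).left_inv hx] at h1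
    rw [Function.comp_apply, (extChartAt J p).left_inv hx, hFf x h1]

/-- The generated set in canonical coordinates `(y, l)`: the base point lies in the slice, and
`l - dF` vanishes on the tangent space of the submanifold, which is the image of `W` under
`DΨ⁻¹`. -/
theorem IsStraightening.mem_generatedSet_iff [FiniteDimensional ℝ V] {μ₀ : CotangentBundle J M}
    (h : IsStraightening J S μ₀.1 Ψ W) {F : V → ℝ} (hF : ContDiffOn ℝ ∞ F Ψ.source) {f : S → ℝ}
    (hf : ∀ x : S, (x : M) ∈ (extChartAt J μ₀.1).source → extChartAt J μ₀.1 x ∈ Ψ.source →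
      f x = F (extChartAt J μ₀.1 x))
    {μ : CotangentBundle J M} (hμ : μ ∈ (extChartAt (cotangentModel J) μ₀).source)
    {y : V × (V →L[ℝ] ℝ)} (hy : extChartAt (cotangentModel J) μ₀ μ = y) (hyΨ : y.1 ∈ Ψ.source) :
    μ ∈ generatedSet J f ↔ Ψ y.1 - Ψ (extChartAt J μ₀.1 μ₀.1) ∈ W ∧
      ∀ w ∈ W, (y.2 - fderiv ℝ F y.1) (fderiv ℝ Ψ.symm (Ψ y.1) w) = 0 := by
  have hμs : μ.1 ∈ (extChartAt J μ₀.1).source := by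
    rw [cotangent_extChartAt_source] at hμ
    exact hμ
  have hy1 : y.1 = extChartAt J μ₀.1 μ.1 := by rw [← hy, cotangent_extChartAt_fst]
  have hy2 : ∀ v : TangentSpace J μ.1,
      y.2 (mfderiv J 𝓘(ℝ, V) (extChartAt J μ₀.1) μ.1 v) = μ.2 v := by
    intro v
    rw [← hy]
    exact cotangent_extChartAt_snd μ₀ μ hμs v
  have hFy : HasFDerivAt F (fderiv ℝ F y.1) y.1 :=
    ((hF.differentiableOn (by simp)).differentiableAt (Ψ.open_source.mem_nhds hyΨ)).hasFDerivAt
  have hΨy : HasFDerivAt Ψ (fderiv ℝ Ψ y.1) y.1 :=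
    ((h.contDiffOn.differentiableOn (by simp)).differentiableAt
      (Ψ.open_source.mem_nhds hyΨ)).hasFDerivAt
  have hmem : μ.1 ∈ S ↔ Ψ y.1 - Ψ (extChartAt J μ₀.1 μ₀.1) ∈ W := by
    rw [← h.mem_iff _ hyΨ, hy1, (extChartAt J μ₀.1).left_inv hμs]
  -- differentiation of `f` along a curve in `S` through the base point of `μ`
  have hderiv : ∀ (c : ℝ → S), IsSmoothCurve J c → ∀ v : TangentSpace J μ.1,
      velocity J (fun t => (c t : M)) 0 = ⟨μ.1, v⟩ →
      deriv (fun t => f (c t)) 0 =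
        fderiv ℝ F y.1 (mfderiv J 𝓘(ℝ, V) (extChartAt J μ₀.1) μ.1 v) := by
    intro c hc v hv
    have h1 := hasDerivAt_extChartAt_comp hc.mdifferentiableAt hv hμs
    have h2 := eventually_mem_extChartAt_source hc.mdifferentiableAt hv hμs
    have hc0 : (c 0 : M) = μ.1 := congrArg TotalSpace.proj hv
    have hc0' : extChartAt J μ₀.1 (c 0) = y.1 := by rw [hc0, hy1]
    have h3 : ∀ᶠ t in 𝓝 (0 : ℝ), extChartAt J μ₀.1 (c t) ∈ Ψ.source :=
      h1.continuousAt.eventually_mem (Ψ.open_source.mem_nhds (by rwa [hc0']))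
    have h4 : HasFDerivAt F (fderiv ℝ F y.1) (extChartAt J μ₀.1 (c 0)) := by rwa [hc0']
    refine ((h4.comp_hasDerivAt 0 h1).congr_of_eventuallyEq ?_).deriv
    filter_upwards [h2, h3] with t ht ht'
    exact hf (c t) ht ht'
  constructor
  · rintro ⟨hμS, hμf⟩
    refine ⟨hmem.1 hμS, fun w hw => ?_⟩
    obtain ⟨c, hc, -, v, hv, hvw⟩ := h.exists_isSmoothCurve hμS hμs (by rwa [← hy1]) hw
    have h1 := hμf c hc v hv
    rw [hderiv c hc v hv, ← hy2, hvw, ← hy1] at h1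
    rw [sub_apply, h1, sub_self]
  · rintro ⟨hμS, hμW⟩
    refine ⟨hmem.2 hμS, fun c hc v hv => ?_⟩
    rw [hderiv c hc v hv, ← hy2]
    have h1 := hasDerivAt_extChartAt_comp hc.mdifferentiableAt hv hμs
    have h2 := eventually_mem_extChartAt_source hc.mdifferentiableAt hv hμs
    set u : V := mfderiv J 𝓘(ℝ, V) (extChartAt J μ₀.1) μ.1 v with hu
    have hc0 : (c 0 : M) = μ.1 := congrArg TotalSpace.proj hv
    have hc0' : extChartAt J μ₀.1 (c 0) = y.1 := by rw [hc0, hy1]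
    have h3 : ∀ᶠ t in 𝓝 (0 : ℝ), extChartAt J μ₀.1 (c t) ∈ Ψ.source :=
      h1.continuousAt.eventually_mem (Ψ.open_source.mem_nhds (by rwa [hc0']))
    have h4 : HasFDerivAt Ψ (fderiv ℝ Ψ y.1) (extChartAt J μ₀.1 (c 0)) := by rwa [hc0']
    have h5 : fderiv ℝ Ψ y.1 u ∈ W := by
      refine hasDerivAt_mem_of_eventually_sub_mem (a := Ψ (extChartAt J μ₀.1 μ₀.1))
        (h4.comp_hasDerivAt 0 h1) ?_
      filter_upwards [h2, h3] with t ht ht'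
      rw [Function.comp_apply, ← h.mem_iff _ ht', (extChartAt J μ₀.1).left_inv ht]
      exact (c t).2
    have h6 := hμW _ h5
    rw [h.fderiv_symm_comp_fderiv hyΨ, sub_apply] at h6
    exact sub_eq_zero.1 h6

end GeneratedSet

/-! ### Straightening of the generated set -/

section Annihilator

variable {V : Type*} [NormedAddCommGroup V] [NormedSpace ℝ V]

/-- The continuous linear forms that vanish on the subspace `W`. -/
def annihilator (W : Submodule ℝ V) : Submodule ℝ (V →L[ℝ] ℝ) where
  carrier := {l | ∀ w ∈ W, l w = 0}
  add_mem' := fun {a b} ha hb w hw => by rw [add_apply, ha w hw, hb w hw, add_zero]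
  zero_mem' := fun w _ => rfl
  smul_mem' := fun c l hl w hw => by rw [smul_apply, hl w hw, smul_zero]

theorem mem_annihilator {W : Submodule ℝ V} {l : V →L[ℝ] ℝ} :
    l ∈ annihilator W ↔ ∀ w ∈ W, l w = 0 := Iff.rfl

/-- This is the dimension count that makes the generated set half-dimensional: the codimension of
`W` lost in the base is regained in the fibre. -/
theorem finrank_prod_annihilator [FiniteDimensional ℝ V] (W : Submodule ℝ V) :
    Module.finrank ℝ (W.prod (annihilator W)) = Module.finrank ℝ V := by
  let e : W.prod (annihilator W) ≃ₗ[ℝ] W × annihilator W :=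
    { toFun x := (⟨x.1.1, x.2.1⟩, ⟨x.1.2, x.2.2⟩)
      invFun x := ⟨(x.1.1, x.2.1), x.1.2, x.2.2⟩
      map_add' _ _ := rfl
      map_smul' _ _ := rfl
      left_inv _ := rfl
      right_inv _ := rfl }
  have h1 : annihilator W = W.dualAnnihilator.comap
      (LinearMap.toContinuousLinearMap (𝕜 := ℝ) (E := V) (F' := ℝ)).symm.toLinearMap := by
    ext l
    simp only [mem_annihilator, Submodule.mem_comap, Submodule.mem_dualAnnihilator]
    rfl
  let e' : W.prod (annihilator W) ≃ₗ[ℝ] W × (V ⧸ W) :=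
    e.trans (LinearEquiv.prodCongr (LinearEquiv.refl ℝ W)
      ((LinearEquiv.ofEq _ _ h1).trans ((LinearEquiv.ofSubmodule' _ _).trans
        (Subspace.quotEquivAnnihilator W).symm)))
  rw [e'.finrank_eq, Module.finrank_prod, add_comm, W.finrank_quotient_add_finrank]

end Annihilator

section Lift

variable {V : Type*} [NormedAddCommGroup V] [NormedSpace ℝ V] {H : Type*} [TopologicalSpace H]
  {J : ModelWithCorners ℝ V H} {M : Type*} [TopologicalSpace M] [ChartedSpace H M]
  {S : Set M} {p : M} {Ψ : OpenPartialHomeomorph V V} {W : Submodule ℝ V}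

/-- The map `(y, l) ↦ (Ψ y, (Ψ⁻¹)^* (l - dF))` on covectors: the cotangent lift of `Ψ` after the
fibre translation by `-dF`. -/
def shiftedLift (Ψ : OpenPartialHomeomorph V V) (F : V → ℝ) (x : V × (V →L[ℝ] ℝ)) :
    V × (V →L[ℝ] ℝ) :=
  (Ψ x.1, (x.2 - fderiv ℝ F x.1).comp (fderiv ℝ Ψ.symm (Ψ x.1)))

/-- The inverse of `shiftedLift`. -/
def shiftedLiftSymm (Ψ : OpenPartialHomeomorph V V) (F : V → ℝ) (x : V × (V →L[ℝ] ℝ)) :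
    V × (V →L[ℝ] ℝ) :=
  (Ψ.symm x.1, x.2.comp (fderiv ℝ Ψ (Ψ.symm x.1)) + fderiv ℝ F (Ψ.symm x.1))

theorem IsStraightening.contDiffOn_shiftedLift (h : IsStraightening J S p Ψ W) {F : V → ℝ}
    (hF : ContDiffOn ℝ ∞ F Ψ.source) :
    ContDiffOn ℝ ∞ (shiftedLift Ψ F) (Ψ.source ×ˢ univ) := by
  have h1 : ContDiffOn ℝ ∞ (fun x : V × (V →L[ℝ] ℝ) => Ψ x.1) (Ψ.source ×ˢ univ) :=
    h.contDiffOn.comp contDiffOn_fst fun x hx => hx.1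
  have h2 : ContDiffOn ℝ ∞ (fun x : V × (V →L[ℝ] ℝ) => fderiv ℝ F x.1) (Ψ.source ×ˢ univ) :=
    (hF.fderiv_of_isOpen Ψ.open_source (m := ∞) (by simp)).comp contDiffOn_fst fun x hx => hx.1
  have h3 : ContDiffOn ℝ ∞ (fun x : V × (V →L[ℝ] ℝ) => fderiv ℝ Ψ.symm (Ψ x.1))
      (Ψ.source ×ˢ univ) :=
    (h.contDiffOn_symm.fderiv_of_isOpen Ψ.open_target (m := ∞) (by simp)).comp h1
      fun x hx => Ψ.map_source hx.1
  exact h1.prodMk ((contDiffOn_snd.sub h2).clm_comp h3)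

theorem IsStraightening.contDiffOn_shiftedLiftSymm (h : IsStraightening J S p Ψ W) {F : V → ℝ}
    (hF : ContDiffOn ℝ ∞ F Ψ.source) :
    ContDiffOn ℝ ∞ (shiftedLiftSymm Ψ F) (Ψ.target ×ˢ univ) := by
  have h1 : ContDiffOn ℝ ∞ (fun x : V × (V →L[ℝ] ℝ) => Ψ.symm x.1) (Ψ.target ×ˢ univ) :=
    h.contDiffOn_symm.comp contDiffOn_fst fun x hx => hx.1
  have h2 : ContDiffOn ℝ ∞ (fun x : V × (V →L[ℝ] ℝ) => fderiv ℝ F (Ψ.symm x.1))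
      (Ψ.target ×ˢ univ) :=
    (hF.fderiv_of_isOpen Ψ.open_source (m := ∞) (by simp)).comp h1 fun x hx => Ψ.map_target hx.1
  have h3 : ContDiffOn ℝ ∞ (fun x : V × (V →L[ℝ] ℝ) => fderiv ℝ Ψ (Ψ.symm x.1))
      (Ψ.target ×ˢ univ) :=
    (h.contDiffOn.fderiv_of_isOpen Ψ.open_source (m := ∞) (by simp)).comp h1
      fun x hx => Ψ.map_target hx.1
  exact h1.prodMk ((contDiffOn_snd.clm_comp h3).add h2)

/-- The local diffeomorphism of `V × V*` that lifts `Ψ` and translates the fibres by `-dF`. -/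
def IsStraightening.liftHomeomorph (h : IsStraightening J S p Ψ W) {F : V → ℝ}
    (hF : ContDiffOn ℝ ∞ F Ψ.source) :
    OpenPartialHomeomorph (V × (V →L[ℝ] ℝ)) (V × (V →L[ℝ] ℝ)) where
  toFun := shiftedLift Ψ F
  invFun := shiftedLiftSymm Ψ F
  source := Ψ.source ×ˢ univ
  target := Ψ.target ×ˢ univ
  map_source' x hx := ⟨Ψ.map_source hx.1, mem_univ _⟩
  map_target' x hx := ⟨Ψ.map_target hx.1, mem_univ _⟩
  left_inv' x hx := by
    refine Prod.ext (Ψ.left_inv hx.1) (ContinuousLinearMap.ext fun v => ?_)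
    simp only [shiftedLift, shiftedLiftSymm, Ψ.left_inv hx.1, add_apply,
      ContinuousLinearMap.comp_apply, h.fderiv_symm_comp_fderiv hx.1, sub_apply, sub_add_cancel]
  right_inv' x hx := by
    refine Prod.ext (Ψ.right_inv hx.1) (ContinuousLinearMap.ext fun v => ?_)
    have h1 := h.fderiv_comp_fderiv_symm (Ψ.map_target hx.1) v
    rw [Ψ.right_inv hx.1] at h1
    simp only [shiftedLift, shiftedLiftSymm, Ψ.right_inv hx.1, add_sub_cancel_right,
      ContinuousLinearMap.comp_apply, h1]
  open_source := Ψ.open_source.prod isOpen_univ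
  open_target := Ψ.open_target.prod isOpen_univ
  continuousOn_toFun := (h.contDiffOn_shiftedLift hF).continuousOn
  continuousOn_invFun := (h.contDiffOn_shiftedLiftSymm hF).continuousOn

/-- The tangent vectors `(a, α)` of the set `{(y, l) | y ∈ S, (l - dF(y))|_{TS} = 0}` satisfy
`⟨α, b⟩ = B(a, b)` on the vectors `b` tangent to `S`, for a symmetric bilinear form `B`. -/
theorem IsStraightening.exists_symmetric (h : IsStraightening J S p Ψ W) {F : V → ℝ}
    (hF : ContDiffOn ℝ ∞ F Ψ.source) {y : V × (V →L[ℝ] ℝ)} (hy : y.1 ∈ Ψ.source) :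
    ∃ B : V → V → ℝ, (∀ a b, B a b = B b a) ∧
      ∀ (ζ : ℝ → V × (V →L[ℝ] ℝ)) (z : V × (V →L[ℝ] ℝ)), ζ 0 = y → HasDerivAt ζ z 0 →
        (∀ᶠ t in 𝓝 (0 : ℝ), ∀ w ∈ W,
          ((ζ t).2 - fderiv ℝ F (ζ t).1) (fderiv ℝ Ψ.symm (Ψ (ζ t).1) w) = 0) →
        ∀ b, fderiv ℝ Ψ y.1 b ∈ W → z.2 b = B z.1 b := by
  have hΨy : HasFDerivAt Ψ (fderiv ℝ Ψ y.1) y.1 :=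
    ((h.contDiffOn.differentiableOn (by simp)).differentiableAt
      (Ψ.open_source.mem_nhds hy)).hasFDerivAt
  have hFc : ContDiffAt ℝ ∞ F y.1 := hF.contDiffAt (Ψ.open_source.mem_nhds hy)
  have hΨc : ContDiffAt ℝ ∞ Ψ.symm (Ψ y.1) :=
    h.contDiffOn_symm.contDiffAt (Ψ.open_target.mem_nhds (Ψ.map_source hy))
  have hle : (2 : ℕ∞ω) ≤ ∞ := WithTop.coe_le_coe.2 (le_top : (2 : ℕ∞) ≤ ⊤)
  have hF2 : HasFDerivAt (fderiv ℝ F) (fderiv ℝ (fderiv ℝ F) y.1) y.1 :=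
    ((hFc.fderiv_right (m := 1) (by simpa [one_add_one_eq_two] using hle)).differentiableAt
      (by simp)).hasFDerivAt
  have hΨ2 : HasFDerivAt (fderiv ℝ Ψ.symm) (fderiv ℝ (fderiv ℝ Ψ.symm) (Ψ y.1)) (Ψ y.1) :=
    ((hΨc.fderiv_right (m := 1) (by simpa [one_add_one_eq_two] using hle)).differentiableAt
      (by simp)).hasFDerivAt
  have hFs : IsSymmSndFDerivAt ℝ F y.1 := hFc.isSymmSndFDerivAt (by simpa using hle)
  have hΨs : IsSymmSndFDerivAt ℝ Ψ.symm (Ψ y.1) := hΨc.isSymmSndFDerivAt (by simpa using hle)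
  -- this form arises by differentiating `(l - dF(y)) (DΨ⁻¹ w) = 0` along a curve, with `w = DΨ b`
  refine ⟨fun a b => fderiv ℝ (fderiv ℝ F) y.1 a b - (y.2 - fderiv ℝ F y.1)
    (fderiv ℝ (fderiv ℝ Ψ.symm) (Ψ y.1) (fderiv ℝ Ψ y.1 a) (fderiv ℝ Ψ y.1 b)), ?_, ?_⟩
  · intro a b
    simp only [hFs a b, hΨs (fderiv ℝ Ψ y.1 a) (fderiv ℝ Ψ y.1 b)]
  · rintro ζ z rfl hζ hW b hb
    have hζ1 : HasDerivAt (fun t => (ζ t).1) z.1 0 :=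
      HasFDerivAt.comp_hasDerivAt (f := ζ) (l := Prod.fst) 0 hasFDerivAt_fst hζ
    have hζ2 : HasDerivAt (fun t => (ζ t).2) z.2 0 :=
      HasFDerivAt.comp_hasDerivAt (f := ζ) (l := Prod.snd) 0 hasFDerivAt_snd hζ
    have h1 := hF2.comp_hasDerivAt 0 hζ1
    have hΨζ : HasDerivAt (fun t => Ψ (ζ t).1) (fderiv ℝ Ψ (ζ 0).1 z.1) 0 :=
      hΨy.comp_hasDerivAt 0 hζ1
    have h2 := hΨ2.comp_hasDerivAt 0 hΨζ
    have h3 := (hζ2.sub h1).clm_apply (h2.clm_apply (hasDerivAt_const 0 (fderiv ℝ Ψ (ζ 0).1 b)))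
    have h4 := h3.unique ((hasDerivAt_const (0 : ℝ) (0 : ℝ)).congr_of_eventuallyEq (by
      filter_upwards [hW] with t ht
      exact ht _ hb))
    simp only [Function.comp_apply, map_zero, add_zero, Pi.sub_apply] at h4
    rw [sub_apply, h.fderiv_symm_comp_fderiv hy] at h4
    dsimp only
    linarith

end Lift

/-! ### The generated set is Lagrangian -/

section Lagrangian

variable {V : Type*} [NormedAddCommGroup V] [NormedSpace ℝ V] [FiniteDimensional ℝ V]
  {H : Type*} [TopologicalSpace H]
  {J : ModelWithCorners ℝ V H} [J.Boundaryless] {M : Type*} [TopologicalSpace M]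
  [ChartedSpace H M] [IsManifold J ∞ M] {S : Set M}

/-- The lifted straightening maps the generated set to a slice parallel to `W × W⁰`, where `W⁰` is
the annihilator of `W`. -/
theorem isEmbeddedSubmanifold_generatedSet {d : ℕ} (hS : IsEmbeddedSubmanifold J S d)
    {f : S → ℝ} (hf : IsSmoothFunction J f) :
    IsEmbeddedSubmanifold (cotangentModel J) (generatedSet J f) (Module.finrank ℝ V) := by
  rw [isEmbeddedSubmanifold_iff]
  intro μ₀ hμ₀
  obtain ⟨Ψ, W, F, h, -, hF, hfF⟩ :=
    hS.exists_isStraightening_of_isSmoothFunction hf hμ₀.1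
  have hmem : ∀ y ∈ (h.liftHomeomorph hF).source,
      (extChartAt (cotangentModel J) μ₀).symm y ∈ generatedSet J f ↔
        Ψ y.1 - Ψ (extChartAt J μ₀.1 μ₀.1) ∈ W ∧
          (shiftedLift Ψ F y).2 ∈ annihilator W := by
    intro y hy
    have hyt : y ∈ (extChartAt (cotangentModel J) μ₀).target := by
      rw [cotangent_extChartAt_target]
      exact ⟨h.source_subset hy.1, mem_univ _⟩
    exact h.mem_generatedSet_iff hF hfF ((extChartAt (cotangentModel J) μ₀).map_target hyt)
      ((extChartAt (cotangentModel J) μ₀).right_inv hyt) hy.1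
  have hsrc : extChartAt (cotangentModel J) μ₀ μ₀ ∈ (h.liftHomeomorph hF).source := by
    refine ⟨?_, mem_univ _⟩
    rw [cotangent_extChartAt_fst]
    exact h.mem_source
  refine ⟨h.liftHomeomorph hF, W.prod (annihilator W),
    ⟨h.contDiffOn_shiftedLift hF, h.contDiffOn_shiftedLiftSymm hF, hsrc, ?_, ?_⟩,
    finrank_prod_annihilator W⟩
  · rw [cotangent_extChartAt_target]
    exact prod_mono_left h.source_subset
  · intro y hy
    have h0 := (hmem _ hsrc).1 (by rwa [extChartAt_to_inv])
    rw [hmem y hy]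
    refine and_congr ?_ (Submodule.sub_mem_iff_left _ h0.2).symm
    rw [← cotangent_extChartAt_fst]
    rfl

/-- In canonical coordinates `ω(X, Y)` is the difference `⟨β, a⟩ - ⟨α, b⟩` for `X = (a, α)` and
`Y = (b, β)`, and both pairings are values of one symmetric bilinear form. -/
theorem canonicalForm_eq_zero_of_mem_tangentVectors {d : ℕ} (hS : IsEmbeddedSubmanifold J S d)
    {f : S → ℝ} (hf : IsSmoothFunction J f) {μ : CotangentBundle J M} (hμ : μ ∈ generatedSet J f)
    {X Y : TangentSpace (cotangentModel J) μ}
    (hX : (⟨μ, X⟩ : TangentBundle (cotangentModel J) (CotangentBundle J M)) ∈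
      tangentVectors (cotangentModel J) (generatedSet J f))
    (hY : (⟨μ, Y⟩ : TangentBundle (cotangentModel J) (CotangentBundle J M)) ∈
      tangentVectors (cotangentModel J) (generatedSet J f)) :
    canonicalForm J μ X Y = 0 := by
  obtain ⟨Ψ, W, F, h, -, hF, hfF⟩ :=
    hS.exists_isStraightening_of_isSmoothFunction hf hμ.1
  set χ := extChartAt (cotangentModel J) μ with hχ
  have hy : (χ μ).1 ∈ Ψ.source := by
    rw [hχ, cotangent_extChartAt_fst]
    exact h.mem_source
  obtain ⟨B, hBs, hB⟩ := h.exists_symmetric hF hy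
  have key : ∀ X : TangentSpace (cotangentModel J) μ,
      (⟨μ, X⟩ : TangentBundle (cotangentModel J) (CotangentBundle J M)) ∈
        tangentVectors (cotangentModel J) (generatedSet J f) →
      ∃ x : V × (V →L[ℝ] ℝ),
        mfderiv (cotangentModel J) 𝓘(ℝ, V × (V →L[ℝ] ℝ)) χ μ X = x ∧
        fderiv ℝ Ψ (χ μ).1 x.1 ∈ W ∧ ∀ b, fderiv ℝ Ψ (χ μ).1 b ∈ W → x.2 b = B x.1 b := by
    rintro X ⟨c, hc, hcX⟩
    have hμχ : μ ∈ χ.source := mem_extChartAt_source μ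
    have hc0 : (c 0 : CotangentBundle J M) = μ := congrArg TotalSpace.proj hcX
    have h1 := hasDerivAt_extChartAt_comp hc.mdifferentiableAt hcX hμχ
    have h2 := eventually_mem_extChartAt_source hc.mdifferentiableAt hcX hμχ
    refine ⟨_, rfl, ?_⟩
    set x : V × (V →L[ℝ] ℝ) := mfderiv (cotangentModel J) 𝓘(ℝ, V × (V →L[ℝ] ℝ)) χ μ X
    have h3 : HasDerivAt (fun t => (χ (c t)).1) x.1 0 :=
      HasFDerivAt.comp_hasDerivAt (f := fun t => χ (c t)) (l := Prod.fst) 0 hasFDerivAt_fst h1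
    have h4 : ∀ᶠ t in 𝓝 (0 : ℝ), (χ (c t)).1 ∈ Ψ.source :=
      h3.continuousAt.eventually_mem (Ψ.open_source.mem_nhds (by rwa [hc0]))
    have h5 : ∀ᶠ t in 𝓝 (0 : ℝ), Ψ (χ (c t)).1 - Ψ (extChartAt J μ.1 μ.1) ∈ W ∧
        ∀ w ∈ W, ((χ (c t)).2 - fderiv ℝ F (χ (c t)).1)
          (fderiv ℝ Ψ.symm (Ψ (χ (c t)).1) w) = 0 := by
      filter_upwards [h2, h4] with t ht ht'
      exact (h.mem_generatedSet_iff hF hfF ht rfl ht').1 (c t).2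
    refine ⟨?_, hB (fun t => χ (c t)) x (by rw [hc0]) h1 (h5.mono fun t ht => ht.2)⟩
    have h6 : HasFDerivAt Ψ (fderiv ℝ Ψ (χ μ).1) (χ (c 0)).1 := by
      rw [hc0]
      exact ((h.contDiffOn.differentiableOn (by simp)).differentiableAt
        (Ψ.open_source.mem_nhds hy)).hasFDerivAt
    exact hasDerivAt_mem_of_eventually_sub_mem (h6.comp_hasDerivAt 0 h3)
      (h5.mono fun t ht => ht.1)
  obtain ⟨x, hXx, hxW, hxB⟩ := key X hX
  obtain ⟨y, hYy, hyW, hyB⟩ := key Y hY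
  rw [canonicalForm_eq μ X Y hXx hYy, hxB _ hyW, hyB _ hxW, hBs, sub_self]

theorem isLagrangianSubmanifold_generatedSet {d : ℕ} (hS : IsEmbeddedSubmanifold J S d)
    {f : S → ℝ} (hf : IsSmoothFunction J f) :
    IsLagrangianSubmanifold (cotangentModel J) (canonicalForm (M := M) J) (generatedSet J f) := by
  refine ⟨⟨Module.finrank ℝ V, ?_, isEmbeddedSubmanifold_generatedSet hS hf⟩, ?_⟩
  · have h1 : Module.finrank ℝ (V →L[ℝ] ℝ) = Module.finrank ℝ V :=
      (LinearMap.toContinuousLinearMap (𝕜 := ℝ) (E := V) (F' := ℝ)).finrank_eq.symm.trans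
        Subspace.dual_finrank_eq
    rw [Module.finrank_prod, h1, two_mul]
  · intro μ hμ X Y hX hY
    exact canonicalForm_eq_zero_of_mem_tangentVectors hS hf hμ hX hY

end Lagrangian

/-! ### Canonical charts of the tangent bundle -/

section TangentChart

variable {V : Type*} [NormedAddCommGroup V] [NormedSpace ℝ V] {H : Type*} [TopologicalSpace H]
  {J : ModelWithCorners ℝ V H} {M : Type*} [TopologicalSpace M] [ChartedSpace H M]

theorem velocity_congr {c c' : ℝ → M} {t : ℝ} (h : c =ᶠ[𝓝 t] c') :
    velocity J c t = velocity J c' t := by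
  have h1 : (mfderiv 𝓘(ℝ, ℝ) J c t (1 : ℝ) : V) = mfderiv 𝓘(ℝ, ℝ) J c' t (1 : ℝ) :=
    DFunLike.congr_fun (h.mfderiv_eq (I := 𝓘(ℝ, ℝ)) (I' := J)) (1 : ℝ)
  exact TotalSpace.ext h.eq_of_nhds (heq_of_eq h1)

variable [IsManifold J 1 M]

theorem tangent_extChartAt_target (p : TangentBundle J M) :
    (extChartAt J.tangent p).target = (extChartAt J p.1).target ×ˢ univ := by
  rw [FiberBundle.extChartAt_target]
  congr 1
  refine inter_eq_left.2 fun y hy => ?_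
  simpa using (extChartAt J p.1).map_target hy

theorem tangent_extChartAt_source (p : TangentBundle J M) :
    (extChartAt J.tangent p).source =
      {v : TangentBundle J M | v.1 ∈ (extChartAt J p.1).source} := by
  rw [FiberBundle.extChartAt]
  ext v
  simp

/-- The fibre coordinate of a tangent vector is its image under the differential of the chart. -/
theorem trivializationAt_snd_eq_mfderiv {p q : M} (hq : q ∈ (extChartAt J p).source)
    (v : TangentSpace J q) :
    (trivializationAt V (TangentSpace J) p ⟨q, v⟩).2 =
      mfderiv J 𝓘(ℝ, V) (extChartAt J p) q v := by
  have hq' : q ∈ (chartAt H p).source := by simpa using hq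
  have h1 := DFunLike.congr_fun (TangentBundle.continuousLinearMapAt_trivializationAt
    (I := J) hq') v
  refine Eq.trans ?_ h1
  have h2 := (trivializationAt V (TangentSpace J : M → Type _) p).coe_linearMapAt_of_mem (R := ℝ)
    (b := q) (by simpa using hq)
  exact (congrFun h2 v).symm

theorem tangent_extChartAt_apply (p v : TangentBundle J M) (hv : v.1 ∈ (extChartAt J p.1).source) :
    extChartAt J.tangent p v =
      (extChartAt J p.1 v.1, mfderiv J 𝓘(ℝ, V) (extChartAt J p.1) v.1 v.2) := by
  rw [FiberBundle.extChartAt]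
  exact Prod.ext rfl (trivializationAt_snd_eq_mfderiv hv v.2)

end TangentChart

/-! ### Smooth integral curves -/

section ODE

variable {V : Type*} [NormedAddCommGroup V] [NormedSpace ℝ V] [CompleteSpace V]

/-- A smooth vector field has a smooth integral curve through every point. -/
theorem exists_contDiffOn_integralCurve {f : V → V} {U : Set V} (hU : IsOpen U)
    (hf : ContDiffOn ℝ ∞ f U) {x₀ : V} (hx₀ : x₀ ∈ U) :
    ∃ (α : ℝ → V) (ε : ℝ), 0 < ε ∧ α 0 = x₀ ∧ ContDiffOn ℝ ∞ α (Ioo (-ε) ε) ∧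
      ∀ t ∈ Ioo (-ε) ε, α t ∈ U ∧ HasDerivAt α (f (α t)) t := by
  have hf1 : ContDiffAt ℝ 1 f x₀ := (hf.contDiffAt (hU.mem_nhds hx₀)).of_le (by simp)
  obtain ⟨α, hα0, ε, hε, hα⟩ :=
    hf1.exists_forall_mem_closedBall_exists_eq_forall_mem_Ioo_hasDerivAt₀ 0
  simp only [zero_sub, zero_add] at hα
  have hc : ContinuousAt α 0 := (hα 0 ⟨by linarith, hε⟩).continuousAt
  have hαU : ∀ᶠ t in 𝓝 (0 : ℝ), α t ∈ U := hc.eventually_mem (hU.mem_nhds (by rwa [hα0]))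
  obtain ⟨δ, hδ, hδU⟩ := Metric.eventually_nhds_iff_ball.1 hαU
  -- the smoothness theorem for solutions needs a closed interval on which the solution stays in `U`
  set η := min ε δ / 2 with hη
  have hm : 0 < min ε δ := lt_min hε hδ
  have hη0 : 0 < η := by positivity
  have hηε : η < ε := by have := min_le_left ε δ; linarith
  have hηδ : η < δ := by have := min_le_right ε δ; linarith
  have hU' : ∀ t ∈ Icc (-η) η, α t ∈ U := fun t ht => hδU t (by
    rw [Real.ball_eq_Ioo]
    exact ⟨by linarith [ht.1], by linarith [ht.2]⟩)
  have hd : ∀ t ∈ Icc (-η) η, HasDerivAt α (f (α t)) t := fun t ht =>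
    hα t ⟨by linarith [ht.1], by linarith [ht.2]⟩
  have hs : ContDiffOn ℝ ((⊤ : ℕ∞) : ℕ∞ω) α (Icc (-η) η) := by
    refine ODE.contDiffOn_enat_Icc_of_hasDerivWithinAt (f := fun _ => f) (u := U) ?_
      (fun t ht => (hd t ht).hasDerivWithinAt) hU'
    exact hf.comp contDiffOn_snd fun x hx => hx.2
  exact ⟨α, η, hη0, hα0, hs.mono Ioo_subset_Icc_self, fun t ht =>
    ⟨hU' t (Ioo_subset_Icc_self ht), hd t (Ioo_subset_Icc_self ht)⟩⟩

end ODE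

/-! ### The submanifold of second-order vectors -/

namespace Distribution

variable {n r : ℕ} {Q : Type*} [TopologicalSpace Q] [ChartedSpace (EuclideanSpace ℝ (Fin n)) Q]
  [IsManifold (𝓡 n) ∞ Q] (D : Distribution n Q r)

local notation "𝔼" => EuclideanSpace ℝ (Fin n)
local notation "𝔽" => EuclideanSpace ℝ (Fin r)

/-- The matrix of a frame is smooth at all points of the chart domain, not only at its centre. -/
theorem contMDiffOn_frameMatrix {U : Set Q} {e : Fin r → ∀ y : Q, TangentSpace (𝓡 n) y}
    (h : IsFrameOn D.space U e) (x₀ : Q) :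
    ContMDiffOn (𝓡 n) 𝓘(ℝ, 𝔽 →L[ℝ] 𝔼) ∞ (frameMatrix e x₀)
      (U ∩ (chartAt 𝔼 x₀).source) := by
  intro x hx
  apply ContMDiffAt.contMDiffWithinAt
  unfold frameMatrix
  refine ContMDiffAt.sum fun A _ => ?_
  have h1 : ContMDiffAt (𝓡 n) (𝓡 n).tangent ∞
      (fun x => (⟨x, e A x⟩ : TangentBundle (𝓡 n) Q)) x :=
    (h.smooth A x hx.1).contMDiffAt (h.isOpen.mem_nhds hx.1)
  have h2 := ((trivializationAt 𝔼 (TangentSpace (𝓡 n)) x₀).contMDiffAt_section_iff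
    (by simpa using hx.2)).1 h1
  exact ((ContinuousLinearMap.smulRightL ℝ 𝔽 𝔼
    (EuclideanSpace.proj A)).contDiff (n := ∞)).contMDiff.contMDiffAt.comp x h2

/-- The inclusion `D → TQ` read in charts: its fibre component is a smooth function. -/
theorem exists_contDiffOn_fiberIncl (p : D.Total) :
    ∃ f : 𝔼 × 𝔽 → 𝔼, ContDiffOn ℝ ∞ f (extChartAt (totalModel n r) p).target ∧
      ∀ q ∈ (extChartAt (totalModel n r) p).source,
        mfderiv (𝓡 n) 𝓘(ℝ, 𝔼) (extChartAt (𝓡 n) p.1) q.1 (D.fiberIncl q.1 q.2) =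
          f (extChartAt (totalModel n r) p q) := by
  -- the preferred trivializations of the bundle `D` are defined by frames
  obtain ⟨U, e, h, ht⟩ : ∃ (U : Set Q) (e : Fin r → ∀ y : Q, TangentSpace (𝓡 n) y)
      (h : IsFrameOn D.space U e), (trivializationAt 𝔽 D.Fiber p.1).toPretrivialization =
        framePretrivialization h :=
    ⟨_, _, (D.exists_frame p.1).choose_spec.choose_spec.2, rfl⟩
  have hbase : (trivializationAt 𝔽 D.Fiber p.1).baseSet = U :=
    congrArg Pretrivialization.baseSet ht
  have happly : ∀ q, trivializationAt 𝔽 D.Fiber p.1 q = framePretrivialization h q := fun q =>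
    congrArg (fun t : Pretrivialization 𝔽 (π 𝔽 D.Fiber) => t q) ht
  refine ⟨fun z => frameMatrix e p.1 ((extChartAt (𝓡 n) p.1).symm z.1) z.2, ?_, ?_⟩
  · rw [FiberBundle.extChartAt_target, hbase]
    refine ContDiffOn.clm_apply ?_ contDiffOn_snd
    have h1 : ContDiffOn ℝ ∞ (frameMatrix e p.1 ∘ (extChartAt (𝓡 n) p.1).symm)
        ((extChartAt (𝓡 n) p.1).target ∩ (extChartAt (𝓡 n) p.1).symm ⁻¹' U) := by
      rw [← contMDiffOn_iff_contDiffOn]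
      refine (D.contMDiffOn_frameMatrix h p.1).comp
        ((contMDiffOn_extChartAt_symm p.1).mono inter_subset_left) fun x hx => ⟨hx.2, ?_⟩
      simpa using (extChartAt (𝓡 n) p.1).map_target hx.1
    exact h1.comp contDiffOn_fst fun z hz => hz.1
  · intro q hq
    rw [FiberBundle.extChartAt] at hq ⊢
    have hqU : q.1 ∈ U := by
      rw [← hbase]
      exact (Trivialization.mem_source _).1 hq.1
    have hqs : q.1 ∈ (extChartAt (𝓡 n) p.1).source := by
      have h2 := hq.2.1
      have h3 : (trivializationAt 𝔽 D.Fiber p.1 q).1 = q.1 := by rw [happly]; rfl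
      rwa [← h3]
    have hqs' : q.1 ∈ (chartAt 𝔼 p.1).source := by simpa using hqs
    change _ = frameMatrix e p.1 ((extChartAt (𝓡 n) p.1).symm
      (extChartAt (𝓡 n) p.1 (trivializationAt 𝔽 D.Fiber p.1 q).1))
        (trivializationAt 𝔽 D.Fiber p.1 q).2
    rw [happly, framePretrivialization_apply h hqU, (extChartAt (𝓡 n) p.1).left_inv hqs,
      frameMatrix_apply h hqU (by simpa using hqs'), LinearEquiv.symm_apply_apply]
    exact (trivializationAt_snd_eq_mfderiv hqs _).symm

/-- The projection `τ : D → Q`. -/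
def proj (p : D.Total) : Q := p.1

theorem contMDiff_proj : ContMDiff (totalModel n r) (𝓡 n) ∞ D.proj :=
  Bundle.contMDiff_proj (n := ∞) (IB := 𝓡 n) (F := 𝔽) D.Fiber

theorem mdifferentiableAt_proj (p : D.Total) :
    MDifferentiableAt (totalModel n r) (𝓡 n) D.proj p :=
  D.contMDiff_proj.mdifferentiable (by simp) p

theorem velocity_proj_comp {γ : ℝ → D.Total} {t : ℝ}
    (hγ : MDifferentiableAt 𝓘(ℝ, ℝ) (totalModel n r) γ t) :
    velocity (𝓡 n) (fun s => (γ s).1) t = ⟨(γ t).1, mfderiv (totalModel n r) (𝓡 n) D.proj (γ t)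
      (velocity (totalModel n r) γ t).2⟩ := by
  have h1 := (D.mdifferentiableAt_proj (γ t)).hasMFDerivAt.comp t hγ.hasMFDerivAt
  have h2 : (mfderiv 𝓘(ℝ, ℝ) (𝓡 n) (fun s => (γ s).1) t (1 : ℝ) : 𝔼) =
    mfderiv (totalModel n r) (𝓡 n) D.proj (γ t) (velocity (totalModel n r) γ t).2 :=
    DFunLike.congr_fun h1.mfderiv (1 : ℝ)
  exact TotalSpace.ext rfl (heq_of_eq h2)

theorem IsAdmissible.mfderiv_proj_eq {γ : ℝ → D.Total} {ε : ℝ} (hε : 0 < ε)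
    (hγ : D.IsAdmissible γ (Ioo (-ε) ε)) :
    mfderiv (totalModel n r) (𝓡 n) D.proj (γ 0) (velocity (totalModel n r) γ 0).2 =
      D.fiberIncl (γ 0).1 (γ 0).2 := by
  obtain ⟨hs, σ, hσ, hσv⟩ := hγ
  have hI : Ioo (-ε) ε ∈ 𝓝 (0 : ℝ) := Ioo_mem_nhds (by simpa using hε) hε
  have h1 := hσv 0 (mem_of_mem_nhds hI)
  have h2 : velocity (𝓡 n) σ 0 = velocity (𝓡 n) (fun s => (γ s).1) 0 := by
    apply velocity_congr
    filter_upwards [hI] with t ht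
    exact (hσ t ht).symm
  rw [h2, D.velocity_proj_comp ((hs.contMDiffAt hI).mdifferentiableAt (by simp))] at h1
  exact (eq_of_heq (TotalSpace.mk.inj h1).2).symm

/-- In charts, the components of the differential of `τ` are those along the base. -/
theorem mfderiv_extChartAt_proj {p q : D.Total}
    (hq : q ∈ (extChartAt (totalModel n r) p).source) (u : TangentSpace (totalModel n r) q) :
    q.1 ∈ (extChartAt (𝓡 n) p.1).source ∧
    mfderiv (𝓡 n) 𝓘(ℝ, 𝔼) (extChartAt (𝓡 n) p.1) q.1
        (mfderiv (totalModel n r) (𝓡 n) D.proj q u) =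
      (mfderiv (totalModel n r) 𝓘(ℝ, 𝔼 × 𝔽) (extChartAt (totalModel n r) p) q u : 𝔼 × 𝔽).1 := by
  have hfst : ∀ z ∈ (extChartAt (totalModel n r) p).source, z.1 ∈ (extChartAt (𝓡 n) p.1).source ∧
      (extChartAt (totalModel n r) p z).1 = extChartAt (𝓡 n) p.1 z.1 := by
    intro z hz
    rw [FiberBundle.extChartAt] at hz ⊢
    have h3 : (trivializationAt 𝔽 D.Fiber p.1 z).1 = z.1 := Trivialization.coe_fst _ hz.1
    refine ⟨?_, congrArg (extChartAt (𝓡 n) p.1) h3⟩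
    rw [← h3]
    exact hz.2.1
  have hq1 := (hfst q hq).1
  refine ⟨hq1, ?_⟩
  have h1 : HasMFDerivAt (totalModel n r) 𝓘(ℝ, 𝔼 × 𝔽) (extChartAt (totalModel n r) p) q
      (mfderiv (totalModel n r) 𝓘(ℝ, 𝔼 × 𝔽) (extChartAt (totalModel n r) p) q) :=
    (mdifferentiableAt_extChartAt (by simpa using hq)).hasMFDerivAt
  have h2 : HasMFDerivAt 𝓘(ℝ, 𝔼 × 𝔽) 𝓘(ℝ, 𝔼) (Prod.fst : 𝔼 × 𝔽 → 𝔼)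
      (extChartAt (totalModel n r) p q) (ContinuousLinearMap.fst ℝ 𝔼 𝔽) :=
    hasFDerivAt_fst.hasMFDerivAt
  have h3 : HasMFDerivAt (𝓡 n) 𝓘(ℝ, 𝔼) (extChartAt (𝓡 n) p.1) (D.proj q)
      (mfderiv (𝓡 n) 𝓘(ℝ, 𝔼) (extChartAt (𝓡 n) p.1) q.1) :=
    (mdifferentiableAt_extChartAt (by rw [← extChartAt_source (𝓡 n)]; exact hq1)).hasMFDerivAt
  have h4 := h3.comp q (D.mdifferentiableAt_proj q).hasMFDerivAt
  have h5 := (h2.comp q h1).congr_of_eventuallyEq (f₁ := extChartAt (𝓡 n) p.1 ∘ D.proj) (by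
    filter_upwards [(isOpen_extChartAt_source p).mem_nhds hq] with z hz
    exact (hfst z hz).2.symm)
  exact DFunLike.congr_fun (hasMFDerivAt_unique h4 h5) u

/-- A vector satisfies `Tτ(v) = j(π(v))` iff, in charts, it satisfies the equation `ẋ = f(x, y)`. -/
theorem mfderiv_proj_eq_iff {p : D.Total} {f : 𝔼 × 𝔽 → 𝔼}
    (hf : ∀ q ∈ (extChartAt (totalModel n r) p).source,
      mfderiv (𝓡 n) 𝓘(ℝ, 𝔼) (extChartAt (𝓡 n) p.1) q.1 (D.fiberIncl q.1 q.2) =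
        f (extChartAt (totalModel n r) p q))
    {q : D.Total} (hq : q ∈ (extChartAt (totalModel n r) p).source)
    (u : TangentSpace (totalModel n r) q) :
    mfderiv (totalModel n r) (𝓡 n) D.proj q u = D.fiberIncl q.1 q.2 ↔
      (mfderiv (totalModel n r) 𝓘(ℝ, 𝔼 × 𝔽) (extChartAt (totalModel n r) p) q u : 𝔼 × 𝔽).1 =
        f (extChartAt (totalModel n r) p q) := by
  obtain ⟨h1, h2⟩ := D.mfderiv_extChartAt_proj hq u
  rw [← h2, ← hf q hq]
  exact ((isInvertible_mfderiv_extChartAt h1).injective.eq_iff).symm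

/-- Every vector `v` with `Tτ(v) = j(π(v))` is tangent to an admissible curve: in charts, to the
integral curve of the vector field `(x, y) ↦ (f(x, y), ẏ)`, where `ẏ` is the vertical component
of `v`. -/
theorem mem_second_of_mfderiv_proj_eq (v : TangentBundle (totalModel n r) D.Total)
    (hv : mfderiv (totalModel n r) (𝓡 n) D.proj v.1 v.2 = D.fiberIncl v.1.1 v.1.2) :
    v ∈ D.second := by
  obtain ⟨p, u⟩ := v
  obtain ⟨f, hfs, hf⟩ := D.exists_contDiffOn_fiberIncl p
  set χ := extChartAt (totalModel n r) p with hχ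
  set w : 𝔼 × 𝔽 := mfderiv (totalModel n r) 𝓘(ℝ, 𝔼 × 𝔽) χ p u
  have hp : p ∈ χ.source := mem_extChartAt_source p
  have hw1 : w.1 = f (χ p) := (D.mfderiv_proj_eq_iff hf hp u).1 hv
  obtain ⟨α, ε, hε, hα0, hαs, hα⟩ := exists_contDiffOn_integralCurve
    (isOpen_extChartAt_target (I := totalModel n r) p) (hfs.prodMk (contDiffOn_const (c := w.2)))
    (mem_extChartAt_target (I := totalModel n r) p)
  let γ : ℝ → D.Total := fun t => χ.symm (α t)
  have hγs : ContMDiffOn 𝓘(ℝ, ℝ) (totalModel n r) ∞ γ (Ioo (-ε) ε) :=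
    (contMDiffOn_extChartAt_symm p).comp hαs.contMDiffOn fun t ht => (hα t ht).1
  have hγd : ∀ t ∈ Ioo (-ε) ε, MDifferentiableAt 𝓘(ℝ, ℝ) (totalModel n r) γ t := fun t ht =>
    (hγs.contMDiffAt (isOpen_Ioo.mem_nhds ht)).mdifferentiableAt (by simp)
  have hγχ : ∀ t ∈ Ioo (-ε) ε, χ (γ t) = α t := fun t ht => χ.right_inv (hα t ht).1
  have hγsrc : ∀ t ∈ Ioo (-ε) ε, γ t ∈ χ.source := fun t ht => χ.map_target (hα t ht).1
  have hvel : ∀ t ∈ Ioo (-ε) ε, (mfderiv (totalModel n r) 𝓘(ℝ, 𝔼 × 𝔽) χ (γ t)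
      (velocity (totalModel n r) γ t).2 : 𝔼 × 𝔽) = (f (α t), w.2) := by
    intro t ht
    have h1 := hasDerivAt_extChartAt_comp (hγd t ht) rfl (hγsrc t ht)
    refine h1.unique ((hα t ht).2.congr_of_eventuallyEq ?_)
    filter_upwards [isOpen_Ioo.mem_nhds ht] with s hs
    exact hγχ s hs
  have h0 : (0 : ℝ) ∈ Ioo (-ε) ε := ⟨by simpa using hε, hε⟩
  refine ⟨ε, hε, γ, ⟨hγs, fun t => (γ t).1, fun t _ => rfl, fun t ht => ?_⟩, ?_⟩
  · rw [D.velocity_proj_comp (hγd t ht)]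
    have h1 := (D.mfderiv_proj_eq_iff hf (hγsrc t ht) (velocity (totalModel n r) γ t).2).2 (by
      rw [hvel t ht, hγχ t ht])
    exact TotalSpace.ext rfl (heq_of_eq h1.symm)
  · have hγ0 : γ 0 = p := by
      change χ.symm (α 0) = p
      rw [hα0]
      exact χ.left_inv hp
    obtain ⟨u', hu'⟩ := exists_velocity_eq (J := totalModel n r) hγ0
    have h1 := hasDerivAt_extChartAt_comp (hγd 0 h0) hu' hp
    have h2 := h1.unique (((hα 0 h0).2).congr_of_eventuallyEq (by
      filter_upwards [isOpen_Ioo.mem_nhds h0] with s hs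
      exact hγχ s hs))
    have h3 : (mfderiv (totalModel n r) 𝓘(ℝ, 𝔼 × 𝔽) χ p u' : 𝔼 × 𝔽) = w := by
      rw [h2, hα0, ← hw1]
      rfl
    rw [hu', (isInvertible_mfderiv_extChartAt hp).injective h3]

/-- The set `D^(2)` consists of the vectors `v` with `Tτ(v) = j(π(v))`. -/
theorem mem_second_iff (v : TangentBundle (totalModel n r) D.Total) :
    v ∈ D.second ↔
      mfderiv (totalModel n r) (𝓡 n) D.proj v.1 v.2 = D.fiberIncl v.1.1 v.1.2 := by
  refine ⟨?_, D.mem_second_of_mfderiv_proj_eq v⟩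
  rintro ⟨ε, hε, γ, hγ, rfl⟩
  exact IsAdmissible.mfderiv_proj_eq D hε hγ

/-- The local diffeomorphism `(x, y, ẋ, ẏ) ↦ (x, y, ẋ - f(x, y), ẏ)`. -/
def shear {f : 𝔼 × 𝔽 → 𝔼} {U : Set (𝔼 × 𝔽)} (hU : IsOpen U) (hf : ContDiffOn ℝ ∞ f U) :
    OpenPartialHomeomorph ((𝔼 × 𝔽) × (𝔼 × 𝔽)) ((𝔼 × 𝔽) × (𝔼 × 𝔽)) where
  toFun z := (z.1, z.2.1 - f z.1, z.2.2)
  invFun z := (z.1, z.2.1 + f z.1, z.2.2)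
  source := U ×ˢ univ
  target := U ×ˢ univ
  map_source' _ hz := ⟨hz.1, mem_univ _⟩
  map_target' _ hz := ⟨hz.1, mem_univ _⟩
  left_inv' z _ := by simp
  right_inv' z _ := by simp
  open_source := hU.prod isOpen_univ
  open_target := hU.prod isOpen_univ
  continuousOn_toFun := continuousOn_fst.prodMk ((continuousOn_snd.fst.sub
    (hf.continuousOn.comp continuousOn_fst fun _ hz => hz.1)).prodMk continuousOn_snd.snd)
  continuousOn_invFun := continuousOn_fst.prodMk ((continuousOn_snd.fst.add
    (hf.continuousOn.comp continuousOn_fst fun _ hz => hz.1)).prodMk continuousOn_snd.snd)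

theorem isEmbeddedSubmanifold_second :
    IsEmbeddedSubmanifold (totalModel n r).tangent D.second (n + 2 * r) := by
  rw [isEmbeddedSubmanifold_iff]
  intro v₀ hv₀
  obtain ⟨f, hfs, hf⟩ := D.exists_contDiffOn_fiberIncl v₀.1
  set χ := extChartAt (totalModel n r) v₀.1 with hχ
  have hU : IsOpen χ.target := isOpen_extChartAt_target v₀.1
  let L : (𝔼 × 𝔽) × (𝔼 × 𝔽) →ₗ[ℝ] 𝔼 := LinearMap.fst ℝ 𝔼 𝔽 ∘ₗ LinearMap.snd ℝ (𝔼 × 𝔽) (𝔼 × 𝔽)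
  have hL : LinearMap.range L = ⊤ :=
    LinearMap.range_eq_top.2 fun x => ⟨(0, x, 0), rfl⟩
  have hmem : ∀ z ∈ χ.target ×ˢ (univ : Set (𝔼 × 𝔽)),
      (extChartAt (totalModel n r).tangent v₀).symm z ∈ D.second ↔ z.2.1 - f z.1 = 0 := by
    intro z hz
    rw [hχ, ← tangent_extChartAt_target] at hz
    set v := (extChartAt (totalModel n r).tangent v₀).symm z with hv
    have hvs : v.1 ∈ χ.source := by
      have h1 := (extChartAt (totalModel n r).tangent v₀).map_target hz
      rw [tangent_extChartAt_source] at h1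
      exact h1
    have h2 := tangent_extChartAt_apply v₀ v hvs
    rw [hv, (extChartAt (totalModel n r).tangent v₀).right_inv hz, ← hv] at h2
    rw [D.mem_second_iff, D.mfderiv_proj_eq_iff hf hvs, sub_eq_zero, h2]
  have hsrc : extChartAt (totalModel n r).tangent v₀ v₀ ∈ χ.target ×ˢ (univ : Set (𝔼 × 𝔽)) := by
    rw [hχ, ← tangent_extChartAt_target]
    exact mem_extChartAt_target v₀
  refine ⟨shear hU hfs, LinearMap.ker L, ⟨?_, ?_, hsrc, ?_, ?_⟩, ?_⟩
  · exact contDiffOn_fst.prodMk ((contDiffOn_snd.fst.sub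
      (hfs.comp contDiffOn_fst fun _ hz => hz.1)).prodMk contDiffOn_snd.snd)
  · exact contDiffOn_fst.prodMk ((contDiffOn_snd.fst.add
      (hfs.comp contDiffOn_fst fun _ hz => hz.1)).prodMk contDiffOn_snd.snd)
  · rw [tangent_extChartAt_target]
    exact subset_rfl
  · intro z hz
    have h0 := (hmem _ hsrc).1 (by rwa [extChartAt_to_inv])
    rw [hmem z hz, LinearMap.mem_ker]
    change _ ↔ (z.2.1 - f z.1) - ((extChartAt (totalModel n r).tangent v₀ v₀).2.1 -
      f (extChartAt (totalModel n r).tangent v₀ v₀).1) = 0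
    rw [h0, sub_zero]
  · have h1 := LinearMap.finrank_range_add_finrank_ker L
    rw [hL, finrank_top] at h1
    simp only [Module.finrank_prod, finrank_euclideanSpace_fin] at h1
    omega

end Distribution

end LagrangianSigma

end

theorem mainTheorem1 {n r : ℕ} {Q : Type*} [TopologicalSpace Q]
    [ChartedSpace (EuclideanSpace ℝ (Fin n)) Q] [IsManifold (𝓡 n) ∞ Q]
    (D : Distribution n Q r) (L : D.second → ℝ)
    (hL : IsSmoothFunction (Distribution.totalModel n r).tangent L) :
    IsEmbeddedSubmanifold (Distribution.totalModel n r).tangent D.second (n + 2 * r) ∧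
      IsLagrangianSubmanifold (cotangentModel (Distribution.totalModel n r).tangent)
        (canonicalForm (M := TangentBundle (Distribution.totalModel n r) D.Total)
          (Distribution.totalModel n r).tangent)
        (generatedSet (Distribution.totalModel n r).tangent L) :=
  ⟨D.isEmbeddedSubmanifold_second,
    isLagrangianSubmanifold_generatedSet D.isEmbeddedSubmanifold_second hL⟩
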